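/- **Theorem (Multi-Source FIM Gain).** Let $L\ge 1$ be the number of sources, $N>L$ the number of antennas, $d_0>0$ the grid spacing and $\lambda=2d_0$ the wavelength, $\sigma>0$, $N_p\ge 1$ the number of snapshots, $P_1,\dots,P_L>0$ the source powers, and let $\boldsymbol\theta=(\theta_1,\dots,\theta_L)$ consist of pairwise distinct angles in $(-\pi/2,\pi/2)$. For positions $p=(p_1,\dots,p_N)$ let $\mathbf A=[\mathbf a(\theta_1),\dots,\mathbf a(\theta_L)]$ with $[\mathbf a(\theta)]_n=e^{j\frac{2\pi}{\lambda}p_n\sin\theta}$, let $\dot{\mathbf A}=[\mathbf a'(\theta_1),\dots,\mathbf a'(\theta_L)]$, let $\mathbf R_s=\mathrm{diag}(P_1,\dots,P_L)$, and let $\boldsymbol\Pi^\perp_{\mathbf A}$ be the orthogonal projector onto the orthogonal complement of the column space of $\mathbf A$ (equal to $\mathbf I-\mathbf A(\mathbf A^H\mathbf A)^{-1}\mathbf A^H$ when $\mathbf A$ has full column rank). The Fisher information matrix is $$\mathbf F(\boldsymbol\theta;p)=\frac{2N_p}{\sigma^2}\,\mathrm{Re}\left\{(\dot{\mathbf A}^H\boldsymbol\Pi^\perp_{\mathbf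 A}\dot{\mathbf A})\odot\mathbf R_s^T\right\},$$ where $\odot$ is the entrywise product. For $D>0$ let $\mathcal P_{\mathrm{FAS}}=[0,D]^N$, and let $\mathcal P_{\mathrm{grid}}$ be the set of $p\in[0,D]^N$ with all $p_n\in\{0,d_0,2d_0,\dots\}$. Fix $\kappa\ge 1$ and let $\mathcal P_{\mathrm{cl}}$ (classical grid arrays, of aperture $O(N^2d_0)$) be the set of $p\in\mathcal P_{\mathrm{grid}}$ with $\max_{i,j}(p_i-p_j)\le \kappa\,\frac{N(N-1)}2\,d_0$. For a class $\mathcal P$ of designs write $\det\mathbf F^*_{\mathcal P}=\max_{p\in\mathcal P}\det\mathbf F(\boldsymbol\theta;p)$, the value at the D-optimal positions, and $G_{\mathcal P}=\det\mathbf F^*_{\mathcal P_{\mathrm{FAS}}}/\det\mathbf F^*_{\mathcal P}$. (i) If $D\ge Ld_0$, then all the maxima above are attained, $\det\mathbf F^*_{\mathcal P}>0$ and $G_{\mathcal P}\ge 1$, for both $\mathcal P=\mathcal P_{\mathrm{grid}}$ and $\mathcal P=\mathcal P_{\mathrm{cl}}$. (ii) Let $D\ge Ld_0$. If $D$ is not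 an integer multiple of $d_0$, then $G_{\mathcal P_{\mathrm{grid}}}>1$ for Lebesgue-almost every such $\boldsymbol\theta$. If $D$ is not an integer multiple of $d_0$ or $D>\kappa\frac{N(N-1)}2d_0$, then $G_{\mathcal P_{\mathrm{cl}}}>1$ for Lebesgue-almost every such $\boldsymbol\theta$. (iii) For fixed $L,N,\kappa,\boldsymbol\theta$, as $D\to\infty$, $$G_{\mathcal P_{\mathrm{cl}}}=\Theta\!\left(\frac{D^{2L}}{N^{2L}(N-1)^{2L}d_0^{2L}}\right):$$ there are constants $c,C,T>0$, depending only on $L,N,\kappa,\boldsymbol\theta$, such that for all $d_0,\sigma,N_p,P_1,\dots,P_L$ as above and all $D\ge Td_0$, the gain $G_{\mathcal P_{\mathrm{cl}}}$ lies between $c$ and $C$ times $D^{2L}/(N^{2L}(N-1)^{2L}d_0^{2L})$. -/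

import Mathlib

open scoped Matrix

noncomputable section

namespace FAS

/-- Steering matrix of the array with positions `p` (wavelength `lam`, angles `θ`):
entry `(n, l)` is `exp (j (2π / lam) pₙ sin θₗ)`. -/
def steeringMatrix {N L : ℕ} (lam : ℝ) (p : Fin N → ℝ) (θ : Fin L → ℝ) :
    Matrix (Fin N) (Fin L) ℂ :=
  Matrix.of fun n l =>
    Complex.exp (Complex.I * ((2 * Real.pi / lam * p n * Real.sin (θ l) : ℝ) : ℂ))

/-- The matrix whose `l`-th column is the derivative of the `l`-th steering vector with respect
to its own angle. -/
def steeringDerivMatrix {N L : ℕ} (lam : ℝ) (p : Fin N → ℝ) (θ : Fin L → ℝ) :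
    Matrix (Fin N) (Fin L) ℂ :=
  Matrix.of fun n l =>
    deriv (fun t : ℝ =>
      Complex.exp (Complex.I * ((2 * Real.pi / lam * p n * Real.sin t : ℝ) : ℂ))) (θ l)

/-- The orthogonal projector onto the orthogonal complement of the column space of `A`. -/
def noiseProjector {N L : ℕ} (A : Matrix (Fin N) (Fin L) ℂ) : Matrix (Fin N) (Fin N) ℂ :=
  (Matrix.toEuclideanCLM (n := Fin N) (𝕜 := ℂ)).symm
    (LinearMap.range (Matrix.toEuclideanLin A))ᗮ.starProjection

/-- For `A` of full column rank the projector is given by the usual formula. -/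
theorem noiseProjector_eq {N L : ℕ} (A : Matrix (Fin N) (Fin L) ℂ)
    (hA : IsUnit (Aᴴ * A).det) :
    noiseProjector A = 1 - A * (Aᴴ * A)⁻¹ * Aᴴ := by
  unfold noiseProjector
  have hinv : (Aᴴ * A) * (Aᴴ * A)⁻¹ = 1 := Matrix.mul_nonsing_inv _ hA
  have h0 : Aᴴ * (1 - A * (Aᴴ * A)⁻¹ * Aᴴ) = 0 := by
    rw [Matrix.mul_sub, Matrix.mul_one, ← Matrix.mul_assoc, ← Matrix.mul_assoc, hinv,
      Matrix.one_mul, sub_self]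
  refine (StarAlgEquiv.symm_apply_eq _).2 ?_
  ext1 x
  refine Submodule.eq_starProjection_of_mem_orthogonal'
    (K := (LinearMap.range (Matrix.toEuclideanLin A))ᗮ)
    (z := Matrix.toEuclideanLin A (WithLp.toLp 2 (((Aᴴ * A)⁻¹ * Aᴴ) *ᵥ x.ofLp))) ?_ ?_ ?_
  · rw [Submodule.mem_orthogonal]
    rintro _ ⟨y, rfl⟩
    rw [EuclideanSpace.inner_eq_star_dotProduct, Matrix.ofLp_toEuclideanCLM,
      Matrix.ofLp_toEuclideanLin_apply, Matrix.star_mulVec, dotProduct_comm,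
      ← Matrix.dotProduct_mulVec, Matrix.mulVec_mulVec, h0, Matrix.zero_mulVec, dotProduct_zero]
  · exact Submodule.le_orthogonal_orthogonal _ ⟨_, rfl⟩
  · apply WithLp.ofLp_injective
    rw [WithLp.ofLp_add, Matrix.ofLp_toEuclideanCLM, Matrix.ofLp_toEuclideanLin_apply,
      Matrix.mulVec_mulVec, Matrix.sub_mulVec, Matrix.one_mulVec, ← Matrix.mul_assoc,
      sub_add_cancel]

/-- Fisher information matrix of the `L` angles for `Np` snapshots, noise level `σ ^ 2` and
uncorrelated sources of powers `P`. -/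
def fim {N L : ℕ} (lam σ : ℝ) (Np : ℕ) (P : Fin L → ℝ) (θ : Fin L → ℝ) (p : Fin N → ℝ) :
    Matrix (Fin L) (Fin L) ℝ :=
  (2 * (Np : ℝ) / σ ^ 2) •
    ((((steeringDerivMatrix lam p θ)ᴴ * noiseProjector (steeringMatrix lam p θ) *
        steeringDerivMatrix lam p θ) ⊙
      (Matrix.diagonal fun l => (P l : ℂ))ᵀ).map Complex.re)

/-- Continuous (fluid antenna) designs: all positions in `[0, D]`. -/
def fasPositions (N : ℕ) (D : ℝ) : Set (Fin N → ℝ) :=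
  {p | ∀ n, p n ∈ Set.Icc 0 D}

/-- Grid designs: all positions in `{0, d₀, 2 d₀, …} ∩ [0, D]`. -/
def gridPositions (N : ℕ) (d₀ D : ℝ) : Set (Fin N → ℝ) :=
  {p | ∀ n, p n ∈ Set.Icc 0 D ∧ ∃ k : ℕ, p n = k * d₀}

/-- Classical grid arrays: grid designs whose aperture is at most `κ N (N - 1) d₀ / 2`. -/
def classicalPositions (κ : ℝ) (N : ℕ) (d₀ D : ℝ) : Set (Fin N → ℝ) :=
  {p | p ∈ gridPositions N d₀ D ∧
    ∀ i j, p i - p j ≤ κ * ((N : ℝ) * ((N : ℝ) - 1) / 2) * d₀}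

/-- The D-optimal value of `det F` over the design class `S`. -/
def optDet {N L : ℕ} (lam σ : ℝ) (Np : ℕ) (P : Fin L → ℝ) (θ : Fin L → ℝ)
    (S : Set (Fin N → ℝ)) : ℝ :=
  sSup ((fun p => (fim lam σ Np P θ p).det) '' S)

/-- `S` contains a D-optimal design, and `optDet` is the value of `det F` there. -/
def HasDOptimal {N L : ℕ} (lam σ : ℝ) (Np : ℕ) (P : Fin L → ℝ) (θ : Fin L → ℝ)
    (S : Set (Fin N → ℝ)) : Prop :=
  ∃ p ∈ S, (∀ q ∈ S, (fim lam σ Np P θ q).det ≤ (fim lam σ Np P θ p).det) ∧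
    optDet lam σ Np P θ S = (fim lam σ Np P θ p).det

/-- The gain of continuous designs in `[0, D]` over the grid class `S`, at spacing `d₀ = lam / 2`. -/
def gain {N L : ℕ} (d₀ σ : ℝ) (Np : ℕ) (P : Fin L → ℝ) (θ : Fin L → ℝ) (D : ℝ)
    (S : Set (Fin N → ℝ)) : ℝ :=
  optDet (2 * d₀) σ Np P θ (fasPositions N D) / optDet (2 * d₀) σ Np P θ S

/-- Admissible angle vectors: pairwise distinct directions in `(-π/2, π/2)`. -/
def IsDOA {L : ℕ} (θ : Fin L → ℝ) : Prop :=
  Function.Injective θ ∧ ∀ l, θ l ∈ Set.Ioo (-(Real.pi / 2)) (Real.pi / 2)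

end FAS

end

/-!
Because the source covariance is diagonal, the Fisher information matrix is diagonal. In units
`x = p / d₀` and with direction sines `u = sin θ`, its determinant is a positive factor independent
of the design (`fimScale`) times `criterion x u`, the product over the sources of the squared
distances from `x ⊙ a_l` to the span of the steering vectors (`det_fim`). The factor cancels in the
gain, so everything is about `criterion`.

Each squared distance is an attained infimum of residual norms. From this come upper semicontinuity
(`isOpen_criterion_lt`), hence optimal continuous designs even though the projector jumps where the
steering matrix drops rank; invariance under translations of the array (`criterion_add`); and the
dilation rule `criterion (t • x) u = t ^ (2 * L) * criterion x (t • u)` (`criterion_smul`).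

Lower bounds come from duality: weights annihilating all steering vectors, paired with `x ⊙ a_l`,
bound the distance from below (`norm_sum_sq_le_sourceSqDist`). On consecutive grid points such
weights are coefficients of polynomials vanishing at the phase increments of the sources, which are
distinct at half-wavelength spacing. This gives a grid design of positive value
(`criterion_stackedGrid_pos`), and, for large `X`, designs in `[0, X]` all of whose squared distances
are at least a constant times `X ^ 2` (`exists_design_growth`). Since the criterion on an array of aperture `B` is
at most `N ^ L * B ^ (2 * L)`, the growth rate of the gain follows.

For strictness, consider a design that can be dilated within `[0, D]`. If it is optimal for the
directions `s • u` and `t • u` on one ray, comparing it with its dilations by `t / s` and `s / t`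
shows that `s ^ (2 * L) * criterion x (s • u)` takes the same positive value at `s` and `t`. That
function is a quotient of analytic functions of `s` (`exists_analytic_quotient`, through Gram
determinants) and tends to zero at `s = 0`, so each positive level set is null
(`volume_level_eq_zero`). Integrating over `s` with Tonelli's theorem and the scaling of Lebesgue
measure, the directions for which the design is optimal form a null set
(`volume_optimalDirections_eq_zero`). A grid class is finite, and under the stated conditions each
of its designs has a translate that can be dilated.
-/

noncomputable section

namespace FAS

/-! ### Squared distance to a span -/

section SpanDistance

variable {E ι : Type*} [NormedAddCommGroup E] [InnerProductSpace ℂ E] [FiniteDimensional ℂ E]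

/-- Squared distance from `b` to the linear span of the family `v`. -/
def spanSqDist (v : ι → E) (b : E) : ℝ :=
  ‖(Submodule.span ℂ (Set.range v))ᗮ.starProjection b‖ ^ 2

theorem spanSqDist_nonneg (v : ι → E) (b : E) : 0 ≤ spanSqDist v b := by
  unfold spanSqDist; positivity

variable [Fintype ι]

theorem spanSqDist_le (v : ι → E) (b : E) (c : ι → ℂ) :
    spanSqDist v b ≤ ‖b - ∑ k, c k • v k‖ ^ 2 := by
  set K := Submodule.span ℂ (Set.range v)
  have hc : ∑ k, c k • v k ∈ K := Submodule.sum_mem _ fun k _ =>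
    Submodule.smul_mem _ _ (Submodule.subset_span ⟨k, rfl⟩)
  have h : Kᗮ.starProjection (∑ k, c k • v k) = 0 := by
    rw [Submodule.starProjection_apply_eq_zero_iff]
    exact Submodule.le_orthogonal_orthogonal _ hc
  have h2 : Kᗮ.starProjection b = Kᗮ.starProjection (b - ∑ k, c k • v k) := by
    rw [map_sub, h, sub_zero]
  unfold spanSqDist
  rw [h2]
  gcongr
  exact Submodule.norm_starProjection_apply_le _ _

theorem exists_starProjection_eq (v : ι → E) (b : E) :
    ∃ c : ι → ℂ,
      (Submodule.span ℂ (Set.range v))ᗮ.starProjection b = b - ∑ k, c k • v k := by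
  set K := Submodule.span ℂ (Set.range v)
  have h : K.starProjection b ∈ K := Submodule.starProjection_apply_mem _ _
  obtain ⟨c, hc⟩ := (Submodule.mem_span_range_iff_exists_fun ℂ).1 h
  exact ⟨c, by rw [hc, Submodule.starProjection_orthogonal_val]⟩

theorem exists_spanSqDist_eq (v : ι → E) (b : E) :
    ∃ c : ι → ℂ, spanSqDist v b = ‖b - ∑ k, c k • v k‖ ^ 2 := by
  obtain ⟨c, hc⟩ := exists_starProjection_eq v b
  exact ⟨c, by rw [← hc, spanSqDist]⟩

/-- Appending a vector to a family multiplies the Gram determinant by the squared distance of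
that vector to the span of the family. -/
theorem det_gram_sumElim [DecidableEq ι] (v : ι → E) (b : E) :
    (Matrix.gram ℂ (Sum.elim v fun _ : Unit => b)).det =
      (Matrix.gram ℂ v).det * (spanSqDist v b : ℂ) := by
  obtain ⟨c, hc⟩ := exists_starProjection_eq v b
  set K := Submodule.span ℂ (Set.range v) with hK
  set r := Kᗮ.starProjection b with hr
  have hrv : ∀ i, inner ℂ (v i) r = 0 := fun i =>
    Submodule.inner_right_of_mem_orthogonal (K := K) (Submodule.subset_span ⟨i, rfl⟩)
      (Submodule.starProjection_apply_mem _ _)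
  have hb : b = ∑ k, c k • v k + r := by rw [hc]; abel
  have hvb : ∀ i, inner ℂ (v i) b = ∑ k, inner ℂ (v i) (v k) * c k := fun i => by
    rw [hb, inner_add_right, hrv, inner_sum, add_zero]
    exact Finset.sum_congr rfl fun k _ => by rw [inner_smul_right, mul_comm]
  have hrb : inner ℂ r b = (spanSqDist v b : ℂ) := by
    have : inner ℂ r (∑ k, c k • v k) = 0 := by
      rw [inner_sum]
      refine Finset.sum_eq_zero fun k _ => ?_
      rw [inner_smul_right, ← inner_conj_symm, hrv]; simp
    nth_rewrite 1 [hb]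
    rw [inner_add_right, this, zero_add, inner_self_eq_norm_sq_to_K]
    simp [spanSqDist, hr, hK]
  have hbb : inner ℂ b b =
      ∑ i, ∑ k, star (c i) * inner ℂ (v i) (v k) * c k + (spanSqDist v b : ℂ) := by
    nth_rewrite 1 [hb]
    rw [inner_add_left, hrb, sum_inner]
    congr 1
    refine Finset.sum_congr rfl fun i _ => ?_
    rw [inner_smul_left, hvb, Finset.mul_sum]
    exact Finset.sum_congr rfl fun k _ => by simp [mul_assoc]
  -- `T` expresses `(v, b)` through `v` and the component `r` of `b` orthogonal to the span
  set T : Matrix (ι ⊕ Unit) (ι ⊕ Unit) ℂ :=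
    Matrix.fromBlocks 1 (Matrix.of fun i _ => c i) 0 1 with hT
  have key : Matrix.gram ℂ (Sum.elim v fun _ : Unit => b) =
      Tᴴ * Matrix.fromBlocks (Matrix.gram ℂ v) 0 0
        (Matrix.of fun _ _ => (spanSqDist v b : ℂ)) * T := by
    rw [hT, Matrix.fromBlocks_conjTranspose, Matrix.fromBlocks_multiply,
      Matrix.fromBlocks_multiply]
    ext (i | i) (j | j)
    · simp
    · simp [Matrix.mul_apply, hvb]
    · simp only [Matrix.gram_apply, Sum.elim_inr, Sum.elim_inl, Matrix.fromBlocks_apply₂₁]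
      rw [← inner_conj_symm, hvb]
      simp [Matrix.mul_apply, mul_comm]
    · simp only [Matrix.gram_apply, Sum.elim_inr, Matrix.fromBlocks_apply₂₂, hbb]
      simp only [Matrix.conjTranspose_one, Matrix.one_mul, Matrix.mul_zero, add_zero,
        Matrix.mul_one, Matrix.add_apply, Matrix.mul_apply, Matrix.conjTranspose_apply,
        Matrix.of_apply, Matrix.gram_apply, zero_add]
      congr 1
      rw [Finset.sum_comm]
      exact Finset.sum_congr rfl fun i _ => by simp [Finset.sum_mul]
  rw [key, Matrix.det_mul, Matrix.det_mul, Matrix.det_conjTranspose, hT,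
    Matrix.det_fromBlocks_zero₂₁, Matrix.det_fromBlocks_zero₂₁]
  simp

/-- A vector orthogonal to the family bounds the distance from below. -/
theorem norm_inner_sq_le_spanSqDist (v : ι → E) (b w : E) (hw : ∀ k, inner ℂ w (v k) = 0) :
    ‖inner ℂ w b‖ ^ 2 ≤ ‖w‖ ^ 2 * spanSqDist v b := by
  obtain ⟨c, hc⟩ := exists_spanSqDist_eq v b
  have : inner ℂ w b = inner ℂ w (b - ∑ k, c k • v k) := by
    rw [inner_sub_right, inner_sum]
    simp [inner_smul_right, hw]
  rw [hc, this, ← mul_pow]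
  gcongr
  exact norm_inner_le_norm _ _

end SpanDistance

/-! ### The normalized design criterion -/

variable {N L : ℕ}

/-- Steering vector of the array with positions `x` in units of half the wavelength, for the
direction sine `s`. -/
def steeringVec (x : Fin N → ℝ) (s : ℝ) : EuclideanSpace ℂ (Fin N) :=
  WithLp.toLp 2 fun n => Complex.exp (Complex.I * ((Real.pi * x n * s : ℝ) : ℂ))

/-- The entrywise product of the positions with the steering vector: the derivative of
`steeringVec` in the direction sine, up to the factor `iπ`. -/
def weightedVec (x : Fin N → ℝ) (s : ℝ) : EuclideanSpace ℂ (Fin N) :=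
  WithLp.toLp 2 fun n => x n * Complex.exp (Complex.I * ((Real.pi * x n * s : ℝ) : ℂ))

/-- Squared distance from the weighted steering vector of source `l` to the signal subspace, the
span of all steering vectors. -/
def sourceSqDist (x : Fin N → ℝ) (u : Fin L → ℝ) (l : Fin L) : ℝ :=
  spanSqDist (fun k => steeringVec x (u k)) (weightedVec x (u l))

theorem sourceSqDist_nonneg (x : Fin N → ℝ) (u : Fin L → ℝ) (l : Fin L) :
    0 ≤ sourceSqDist x u l :=
  spanSqDist_nonneg _ _

/-- The normalized D-optimality criterion: product over the sources of `sourceSqDist`, for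
positions `x` in units of the grid spacing and direction sines `u`. -/
def criterion (x : Fin N → ℝ) (u : Fin L → ℝ) : ℝ :=
  ∏ l, sourceSqDist x u l

theorem norm_exp_I_mul_ofReal (t : ℝ) : ‖Complex.exp (Complex.I * (t : ℂ))‖ = 1 := by
  rw [mul_comm]; exact Complex.norm_exp_ofReal_mul_I t

theorem range_toEuclideanLin {r : ℕ} (A : Matrix (Fin N) (Fin r) ℂ) :
    LinearMap.range (Matrix.toEuclideanLin A) =
      Submodule.span ℂ (Set.range fun k => (WithLp.toLp 2 (fun n => A n k) :
        EuclideanSpace ℂ (Fin N))) := by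
  ext y
  rw [Submodule.mem_span_range_iff_exists_fun, LinearMap.mem_range]
  have h : ∀ c : Fin r → ℂ, Matrix.toEuclideanLin A (WithLp.toLp 2 c) =
      ∑ k, c k • (WithLp.toLp 2 (fun n => A n k) : EuclideanSpace ℂ (Fin N)) := fun c => by
    ext n
    simp [Matrix.mulVec, dotProduct, mul_comm, Matrix.toLpLin_apply]
  exact ⟨fun ⟨c, hc⟩ => ⟨c.ofLp, by rw [← h]; exact hc⟩, fun ⟨c, hc⟩ => ⟨WithLp.toLp 2 c, by
    rw [h]; exact hc⟩⟩

theorem star_dotProduct_noiseProjector {r : ℕ} (A : Matrix (Fin N) (Fin r) ℂ)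
    (b : Fin N → ℂ) :
    star b ⬝ᵥ (noiseProjector A *ᵥ b) =
      (spanSqDist (fun k => (WithLp.toLp 2 (fun n => A n k) : EuclideanSpace ℂ (Fin N)))
        (WithLp.toLp 2 b) : ℂ) := by
  rw [spanSqDist]
  simp only [← range_toEuclideanLin]
  set K := (LinearMap.range (Matrix.toEuclideanLin A))ᗮ
  have h : noiseProjector A *ᵥ b = (K.starProjection (WithLp.toLp 2 b)).ofLp := by
    have := Matrix.ofLp_toEuclideanCLM (𝕜 := ℂ) (noiseProjector A) (WithLp.toLp 2 b)
    rw [← this]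
    unfold noiseProjector
    rw [StarAlgEquiv.apply_symm_apply]
  rw [h, dotProduct_comm]
  have h2 : (K.starProjection (WithLp.toLp 2 b)).ofLp ⬝ᵥ star b =
      inner ℂ (WithLp.toLp 2 b) (K.starProjection (WithLp.toLp 2 b)) := by
    rw [EuclideanSpace.inner_eq_star_dotProduct]
  rw [h2]
  conv_lhs =>
    rw [← Submodule.starProjection_eq_self_iff.2 (Submodule.starProjection_apply_mem K _),
      ← Submodule.inner_starProjection_left_eq_right, inner_self_eq_norm_sq_to_K]
  exact (Complex.ofReal_pow _ _).symm

/-- The factor by which the Fisher information determinant exceeds the normalized criterion. -/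
def fimScale (σ : ℝ) (Np : ℕ) (P θ : Fin L → ℝ) : ℝ :=
  ∏ l, (2 * (Np : ℝ) / σ ^ 2 * P l * (Real.pi * Real.cos (θ l)) ^ 2)

theorem fimScale_pos {σ : ℝ} {Np : ℕ} {P θ : Fin L → ℝ} (hσ : 0 < σ) (hNp : 1 ≤ Np)
    (hP : ∀ l, 0 < P l) (hθ : IsDOA θ) : 0 < fimScale σ Np P θ := by
  refine Finset.prod_pos fun l _ => ?_
  have h1 := Real.cos_pos_of_mem_Ioo (hθ.2 l)
  have h2 := hP l
  have h3 : (0 : ℝ) < Np := by exact_mod_cast hNp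
  positivity

theorem steeringDerivMatrix_apply {lam : ℝ} (p : Fin N → ℝ) (θ : Fin L → ℝ) (n l) :
    steeringDerivMatrix lam p θ n l =
      Complex.exp (Complex.I * ((2 * Real.pi / lam * p n * Real.sin (θ l) : ℝ) : ℂ)) *
        (Complex.I * ((2 * Real.pi / lam * p n * Real.cos (θ l) : ℝ) : ℂ)) := by
  have h1 : HasDerivAt (fun t : ℝ => 2 * Real.pi / lam * p n * Real.sin t)
      (2 * Real.pi / lam * p n * Real.cos (θ l)) (θ l) :=
    (Real.hasDerivAt_sin _).const_mul _
  exact ((h1.ofReal_comp.const_mul Complex.I).cexp).deriv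

theorem det_fim {d₀ : ℝ} (hd : 0 < d₀) (σ : ℝ) (Np : ℕ) (P θ : Fin L → ℝ) (p : Fin N → ℝ) :
    (fim (2 * d₀) σ Np P θ p).det =
      fimScale σ Np P θ * criterion (fun n => p n / d₀) (fun l => Real.sin (θ l)) := by
  set x : Fin N → ℝ := fun n => p n / d₀ with hx
  set A := steeringMatrix (2 * d₀) p θ with hA
  set B := steeringDerivMatrix (2 * d₀) p θ with hB
  have hphase : ∀ n (s : ℝ), 2 * Real.pi / (2 * d₀) * p n * s = Real.pi * x n * s := fun n s => by
    simp only [hx]; field_simp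
  have hAcol : (fun k => (WithLp.toLp 2 (fun n => A n k) : EuclideanSpace ℂ (Fin N))) =
      fun k => steeringVec x (Real.sin (θ k)) := by
    funext k
    simp only [hA, steeringMatrix, steeringVec, Matrix.of_apply, hphase]
  have hdiag : ∀ l, (Bᴴ * noiseProjector A * B) l l =
      (((Real.pi * Real.cos (θ l)) ^ 2 *
        spanSqDist (fun k => steeringVec x (Real.sin (θ k)))
          (weightedVec x (Real.sin (θ l))) : ℝ) : ℂ) := fun l => by
    set b : Fin N → ℂ := (weightedVec x (Real.sin (θ l))).ofLp with hb
    set z : ℂ := Complex.I * ((Real.pi * Real.cos (θ l) : ℝ) : ℂ) with hz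
    have hcol : (fun n => B n l) = z • b := by
      funext n
      simp only [hB, steeringDerivMatrix_apply, hphase, hb, hz, weightedVec, Pi.smul_apply,
        smul_eq_mul]
      push_cast
      ring
    have h1 : (Bᴴ * noiseProjector A * B) l l =
        star (fun n => B n l) ⬝ᵥ (noiseProjector A *ᵥ fun n => B n l) := by
      rw [Matrix.mul_assoc, Matrix.mul_apply_eq_vecMul, Matrix.vecMul, dotProduct]
      rfl
    have hzz : star z * z = (((Real.pi * Real.cos (θ l)) ^ 2 : ℝ) : ℂ) := by
      rw [hz]
      simp only [star_mul', Complex.star_def, Complex.conj_I, Complex.conj_ofReal]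
      push_cast
      linear_combination (-(Real.pi * Complex.cos (θ l)) ^ 2) * Complex.I_sq
    rw [h1, hcol, star_smul, Matrix.mulVec_smul, smul_dotProduct, dotProduct_smul,
      star_dotProduct_noiseProjector, hAcol, smul_smul, hzz, smul_eq_mul, ← Complex.ofReal_mul]
  have hF : fim (2 * d₀) σ Np P θ p = Matrix.diagonal fun l =>
      2 * (Np : ℝ) / σ ^ 2 * P l * (Real.pi * Real.cos (θ l)) ^ 2 *
        spanSqDist (fun k => steeringVec x (Real.sin (θ k)))
          (weightedVec x (Real.sin (θ l))) := by
    ext i j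
    rw [fim, Matrix.smul_apply, Matrix.map_apply, Matrix.hadamard_apply, Matrix.transpose_apply]
    by_cases hij : i = j
    · subst hij
      rw [Matrix.diagonal_apply_eq, Matrix.diagonal_apply_eq, hdiag, ← Complex.ofReal_mul,
        Complex.ofReal_re, smul_eq_mul]
      ring
    · rw [Matrix.diagonal_apply_ne _ (Ne.symm hij), Matrix.diagonal_apply_ne _ hij]
      simp
  rw [hF, Matrix.det_diagonal, Finset.prod_mul_distrib]
  rfl

/-- Squared norm of the residual of the weighted steering vector of source `l` after subtracting
the combination of steering vectors with coefficients `c`. -/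
def sqResidual (x : Fin N → ℝ) (u : Fin L → ℝ) (l : Fin L) (c : Fin L → ℂ) : ℝ :=
  ∑ n, ‖(x n : ℂ) * Complex.exp (Complex.I * ((Real.pi * x n * u l : ℝ) : ℂ)) -
    ∑ k, c k * Complex.exp (Complex.I * ((Real.pi * x n * u k : ℝ) : ℂ))‖ ^ 2

theorem sqResidual_eq (x : Fin N → ℝ) (u : Fin L → ℝ) (l : Fin L) (c : Fin L → ℂ) :
    sqResidual x u l c =
      ‖weightedVec x (u l) - ∑ k, c k • steeringVec x (u k)‖ ^ 2 := by
  rw [EuclideanSpace.norm_sq_eq, sqResidual]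
  refine Finset.sum_congr rfl fun n _ => ?_
  simp [weightedVec, steeringVec]

theorem sourceSqDist_le (x : Fin N → ℝ) (u : Fin L → ℝ) (l : Fin L) (c : Fin L → ℂ) :
    sourceSqDist x u l ≤ sqResidual x u l c := by
  rw [sqResidual_eq]; exact spanSqDist_le _ _ _

theorem exists_sourceSqDist_eq (x : Fin N → ℝ) (u : Fin L → ℝ) (l : Fin L) :
    ∃ c, sourceSqDist x u l = sqResidual x u l c := by
  obtain ⟨c, hc⟩ := exists_spanSqDist_eq (fun k => steeringVec x (u k)) (weightedVec x (u l))
  exact ⟨c, by rw [sqResidual_eq, ← hc]; rfl⟩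

theorem sourceSqDist_le_sum_sq (x : Fin N → ℝ) (u : Fin L → ℝ) (l : Fin L) :
    sourceSqDist x u l ≤ ∑ n, x n ^ 2 := by
  refine (sourceSqDist_le x u l 0).trans_eq (Finset.sum_congr rfl fun n _ => ?_)
  simp only [Pi.zero_apply, zero_mul, Finset.sum_const_zero, sub_zero, norm_mul,
    norm_exp_I_mul_ofReal, mul_one, Complex.norm_real, Real.norm_eq_abs, sq_abs]

theorem criterion_le (x : Fin N → ℝ) (u : Fin L → ℝ) : criterion x u ≤ (∑ n, x n ^ 2) ^ L := by
  refine (Finset.prod_le_prod (fun l _ => sourceSqDist_nonneg x u l)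
    fun l _ => sourceSqDist_le_sum_sq x u l).trans_eq ?_
  simp

theorem sourceSqDist_smul_le (t : ℝ) (x : Fin N → ℝ) (u : Fin L → ℝ) (l : Fin L) :
    sourceSqDist (t • x) u l ≤ t ^ 2 * sourceSqDist x (t • u) l := by
  obtain ⟨c, hc⟩ := exists_sourceSqDist_eq x (t • u) l
  refine (sourceSqDist_le _ _ _ fun k => t * c k).trans_eq ?_
  rw [hc, sqResidual, sqResidual, Finset.mul_sum]
  refine Finset.sum_congr rfl fun n _ => ?_
  have h : ∀ k, Real.pi * (t • x) n * u k = Real.pi * x n * (t • u) k := fun k => by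
    simp only [Pi.smul_apply, smul_eq_mul]; ring
  have h2 : (t : ℝ) ^ 2 = ‖(t : ℂ)‖ ^ 2 := by simp
  simp only [h]
  rw [h2, ← mul_pow, ← norm_mul, mul_sub, Finset.mul_sum]
  simp only [Pi.smul_apply, smul_eq_mul, Complex.ofReal_mul, mul_assoc]

/-- Dilating the array is the same as dilating the direction sines, up to the factor picked up
by the position weights. -/
theorem sourceSqDist_smul {t : ℝ} (ht : 0 < t) (x : Fin N → ℝ) (u : Fin L → ℝ) (l : Fin L) :
    sourceSqDist (t • x) u l = t ^ 2 * sourceSqDist x (t • u) l := by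
  refine le_antisymm (sourceSqDist_smul_le t x u l) ?_
  have h := sourceSqDist_smul_le t⁻¹ (t • x) (t • u) l
  rw [inv_smul_smul₀ ht.ne', inv_smul_smul₀ ht.ne', inv_pow] at h
  calc t ^ 2 * sourceSqDist x (t • u) l
      ≤ t ^ 2 * ((t ^ 2)⁻¹ * sourceSqDist (t • x) u l) := by gcongr
    _ = sourceSqDist (t • x) u l := by rw [mul_inv_cancel_left₀ (by positivity)]

theorem criterion_smul {t : ℝ} (ht : 0 < t) (x : Fin N → ℝ) (u : Fin L → ℝ) :
    criterion (t • x) u = t ^ (2 * L) * criterion x (t • u) := by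
  simp only [criterion, sourceSqDist_smul ht, Finset.prod_mul_distrib]
  simp [pow_mul]

theorem sourceSqDist_add_le (a : ℝ) (x : Fin N → ℝ) (u : Fin L → ℝ) (l : Fin L) :
    sourceSqDist (fun n => x n + a) u l ≤ sourceSqDist x u l := by
  obtain ⟨c, hc⟩ := exists_sourceSqDist_eq x u l
  set e : Fin L → ℂ := fun k => Complex.exp (Complex.I * ((Real.pi * a * u k : ℝ) : ℂ)) with he
  have hek : ∀ k, e k ≠ 0 := fun k => Complex.exp_ne_zero _
  have hadd : ∀ n k, Complex.exp (Complex.I * ((Real.pi * (x n + a) * u k : ℝ) : ℂ)) =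
      Complex.exp (Complex.I * ((Real.pi * x n * u k : ℝ) : ℂ)) * e k := fun n k => by
    rw [he, ← Complex.exp_add]; push_cast; ring_nf
  -- the shift contributes a multiple of the steering vector of the source itself
  refine (sourceSqDist_le _ _ _ fun k => c k * e l / e k + if k = l then (a : ℂ) else 0).trans_eq ?_
  rw [hc, sqResidual, sqResidual]
  refine Finset.sum_congr rfl fun n _ => ?_
  have h1 : ∑ k, (c k * e l / e k + if k = l then (a : ℂ) else 0) *
      Complex.exp (Complex.I * ((Real.pi * (x n + a) * u k : ℝ) : ℂ)) =
      e l * ∑ k, c k * Complex.exp (Complex.I * ((Real.pi * x n * u k : ℝ) : ℂ)) +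
        a * (Complex.exp (Complex.I * ((Real.pi * x n * u l : ℝ) : ℂ)) * e l) := by
    simp only [add_mul, Finset.sum_add_distrib, ite_mul, zero_mul, Finset.sum_ite_eq',
      Finset.mem_univ, if_true, hadd, Finset.mul_sum]
    congr 1
    refine Finset.sum_congr rfl fun k _ => ?_
    field_simp [hek k]
  rw [h1, hadd]
  have h2 : ((x n + a : ℝ) : ℂ) *
      (Complex.exp (Complex.I * ((Real.pi * x n * u l : ℝ) : ℂ)) * e l) -
      (e l * ∑ k, c k * Complex.exp (Complex.I * ((Real.pi * x n * u k : ℝ) : ℂ)) +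
        a * (Complex.exp (Complex.I * ((Real.pi * x n * u l : ℝ) : ℂ)) * e l)) =
      ((x n : ℂ) * Complex.exp (Complex.I * ((Real.pi * x n * u l : ℝ) : ℂ)) -
        ∑ k, c k * Complex.exp (Complex.I * ((Real.pi * x n * u k : ℝ) : ℂ))) * e l := by
    push_cast; ring
  rw [h2, norm_mul, he, norm_exp_I_mul_ofReal, mul_one]

/-- The criterion is invariant under translations of the array. -/
theorem criterion_add (a : ℝ) (x : Fin N → ℝ) (u : Fin L → ℝ) :
    criterion (fun n => x n + a) u = criterion x u := by
  rw [criterion, criterion]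
  refine Finset.prod_congr rfl fun l _ => le_antisymm (sourceSqDist_add_le a x u l) ?_
  have := sourceSqDist_add_le (-a) (fun n => x n + a) u l
  simpa using this

/-! ### Semicontinuity of the criterion -/

/-- Each squared distance is an attained infimum of residuals continuous in the design and the
directions, so the criterion is upper semicontinuous, also where the steering matrix drops rank. -/
theorem isOpen_criterion_lt (r : ℝ) :
    IsOpen {z : (Fin N → ℝ) × (Fin L → ℝ) | criterion z.1 z.2 < r} := by
  rw [isOpen_iff_mem_nhds]
  rintro ⟨x, u⟩ h
  choose c hc using exists_sourceSqDist_eq x u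
  have hcont : Continuous fun z : (Fin N → ℝ) × (Fin L → ℝ) =>
      ∏ l, sqResidual z.1 z.2 l (c l) := by
    unfold sqResidual; fun_prop
  have hlt : ∏ l, sqResidual x u l (c l) < r := by
    simpa only [Set.mem_ofPred_eq, criterion, hc] using h
  filter_upwards [(hcont.tendsto (x, u)).eventually (gt_mem_nhds hlt)] with z hz
  exact (Finset.prod_le_prod (fun l _ => sourceSqDist_nonneg _ _ l)
    fun l _ => sourceSqDist_le _ _ _ _).trans_lt hz

theorem upperSemicontinuous_criterion (u : Fin L → ℝ) :
    UpperSemicontinuous fun x : Fin N → ℝ => criterion x u := by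
  rw [upperSemicontinuous_iff_isOpen_preimage]
  intro r
  exact (isOpen_criterion_lt r).preimage (by fun_prop : Continuous fun x => (x, u))

theorem isOpen_forall_criterion_lt {K : Set (Fin N → ℝ)} (hK : IsCompact K) (r : ℝ) :
    IsOpen {u : Fin L → ℝ | ∀ q ∈ K, criterion q u < r} := by
  rw [isOpen_iff_mem_nhds]
  intro u hu
  have hsub : K ×ˢ ({u} : Set (Fin L → ℝ)) ⊆ {z | criterion z.1 z.2 < r} := by
    intro z hz
    have h1 : z.2 = u := hz.2
    have h2 : criterion z.1 u < r := hu z.1 hz.1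
    rw [← h1] at h2
    exact h2
  obtain ⟨V, W, -, hW, hKV, huW, hVW⟩ :=
    generalized_tube_lemma hK isCompact_singleton (isOpen_criterion_lt r) hsub
  have hWu : W ∈ nhds u := hW.mem_nhds (Set.singleton_subset_iff.1 huW)
  refine Filter.mem_of_superset hWu fun v hv q hq => ?_
  have h : (q, v) ∈ {z : (Fin N → ℝ) × (Fin L → ℝ) | criterion z.1 z.2 < r} :=
    hVW (Set.mk_mem_prod (hKV hq) hv)
  exact h

/-! ### Analyticity along dilations of the directions -/

section Analytic

theorem analyticAt_inner_of_coord {f g : ℝ → EuclideanSpace ℂ (Fin N)} {s : ℝ}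
    (hf : ∀ n, AnalyticAt ℝ (fun t => (f t).ofLp n) s)
    (hg : ∀ n, AnalyticAt ℝ (fun t => (g t).ofLp n) s) :
    AnalyticAt ℝ (fun t => inner ℂ (f t) (g t)) s := by
  simp only [PiLp.inner_apply, RCLike.inner_apply]
  refine Finset.analyticAt_fun_sum _ fun n _ => (hg n).mul ?_
  exact (Complex.conjCLE.toContinuousLinearMap.analyticAt _).comp (hf n)

theorem analyticAt_det {ι : Type*} [Fintype ι] [DecidableEq ι] {M : ℝ → Matrix ι ι ℂ} {s : ℝ}
    (hM : ∀ i j, AnalyticAt ℝ (fun t => M t i j) s) : AnalyticAt ℝ (fun t => (M t).det) s := by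
  simp only [Matrix.det_apply']
  exact Finset.analyticAt_fun_sum _ fun σ _ => analyticAt_const.mul
    (Finset.analyticAt_fun_prod _ fun i _ => hM _ _)

theorem analyticAt_exp_dilate (a b s : ℝ) :
    AnalyticAt ℝ (fun t : ℝ => Complex.exp (Complex.I * ((Real.pi * a * (t * b) : ℝ) : ℂ))) s := by
  have h0 : AnalyticAt ℝ (fun t : ℝ => Real.pi * a * (t * b)) s := by fun_prop
  have h1 : AnalyticAt ℝ (fun t : ℝ => Complex.I * ((Real.pi * a * (t * b) : ℝ) : ℂ)) s :=
    analyticAt_const.mul ((Complex.ofRealCLM.analyticAt _).comp h0)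
  have h2 : AnalyticAt ℝ Complex.exp (Complex.I * ((Real.pi * a * (s * b) : ℝ) : ℂ)) :=
    analyticAt_cexp.restrictScalars
  exact AnalyticAt.fun_comp
    (f := fun t : ℝ => Complex.I * ((Real.pi * a * (t * b) : ℝ) : ℂ)) h2 h1

theorem analyticAt_gram_det {ι : Type*} [Fintype ι] [DecidableEq ι]
    {v : ℝ → ι → EuclideanSpace ℂ (Fin N)} {s : ℝ}
    (hv : ∀ i n, AnalyticAt ℝ (fun t => (v t i).ofLp n) s) :
    AnalyticAt ℝ (fun t => (Matrix.gram ℂ (v t)).det) s :=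
  analyticAt_det fun i j => analyticAt_inner_of_coord (hv i) (hv j)

theorem ae_ne_zero_of_analytic {f : ℝ → ℂ} (hf : ∀ s, AnalyticAt ℝ f s) {s₀ : ℝ}
    (h : f s₀ ≠ 0) : ∀ᵐ s : ℝ, f s ≠ 0 := by
  have h1 : AnalyticOnNhd ℝ f Set.univ := fun s _ => hf s
  have h2 := h1.preimage_zero_mem_codiscrete h
  have h3 := ae_restrict_le_codiscreteWithin (μ := MeasureTheory.volume)
    (MeasurableSet.univ (α := ℝ)) h2
  rwa [MeasureTheory.Measure.restrict_univ] at h3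

/-- Along a ray of directions the criterion is a quotient of analytic functions whose denominator
does not vanish identically. The denominator is a power of the Gram determinant of a set `J` of
steering vectors that is maximal among the sets independent somewhere on the ray: wherever `J` is
independent, it spans the whole signal subspace. -/
theorem exists_analytic_quotient (x : Fin N → ℝ) (u : Fin L → ℝ) :
    ∃ g k : ℝ → ℂ, (∀ s, AnalyticAt ℝ g s) ∧ (∀ s, AnalyticAt ℝ k s) ∧ (∃ s, g s ≠ 0) ∧
      ∀ s, g s ≠ 0 → g s * (criterion x (s • u) : ℂ) = k s := by
  classical
  set v : ℝ → Fin L → EuclideanSpace ℂ (Fin N) := fun s k => steeringVec x (s * u k) with hv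
  obtain ⟨J, hJ⟩ := (Set.toFinite {J : Set (Fin L) | ∃ s, LinearIndepOn ℂ (v s) J}).exists_maximal
    ⟨∅, 0, linearIndepOn_empty ℂ _⟩
  obtain ⟨s₀, hs₀⟩ := hJ.1
  have hvan : ∀ s k n, AnalyticAt ℝ (fun t => (v t k).ofLp n) s := fun s k n =>
    analyticAt_exp_dilate (x n) (u k) s
  set g₀ : ℝ → ℂ := fun s => (Matrix.gram ℂ fun j : J => v s j).det with hg₀
  set k₀ : Fin L → ℝ → ℂ := fun l s => (Matrix.gram ℂ
    (Sum.elim (fun j : J => v s j) fun _ : Unit => weightedVec x (s * u l))).det with hk₀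
  have hspan : ∀ s, g₀ s ≠ 0 → Submodule.span ℂ (Set.range fun j : J => v s j) =
      Submodule.span ℂ (Set.range (v s)) := fun s hs => by
    have hli : LinearIndepOn ℂ (v s) J := Matrix.det_gram_ne_zero_iff_linearIndependent.1 hs
    refine le_antisymm (Submodule.span_mono ?_) (Submodule.span_le.2 ?_)
    · rintro _ ⟨j, rfl⟩; exact ⟨j, rfl⟩
    · rintro _ ⟨k, rfl⟩
      by_contra hk
      have hr : (Set.range fun j : J => v s j) = v s '' J := by
        ext y; simp
      rw [hr] at hk
      have hkJ : k ∈ J := hJ.2 ⟨s, hli.insert hk⟩ (Set.subset_insert k J) (Set.mem_insert k J)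
      exact hk (Submodule.subset_span ⟨k, hkJ, rfl⟩)
  refine ⟨fun s => g₀ s ^ L, fun s => ∏ l, k₀ l s, fun s => ?_, fun s => ?_, ⟨s₀, ?_⟩, ?_⟩
  · exact (analyticAt_gram_det (v := fun t (j : J) => v t j) fun j n => hvan s j n).fun_pow L
  · refine Finset.analyticAt_fun_prod _ fun l _ => analyticAt_gram_det ?_
    rintro (j | _) n
    · exact hvan s j n
    · exact analyticAt_const.mul (analyticAt_exp_dilate (x n) (u l) s)
  · exact pow_ne_zero _ (Matrix.det_gram_ne_zero_iff_linearIndependent.2 hs₀)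
  · intro s hs
    have hg : g₀ s ≠ 0 := fun h => by
      by_cases hL : L = 0
      · subst hL
        have : IsEmpty J := ⟨fun j => j.1.elim0⟩
        simp [hg₀] at h
      · exact hs (by simp only [h]; exact zero_pow hL)
    simp only [hk₀, det_gram_sumElim, Finset.prod_mul_distrib, criterion, Complex.ofReal_prod]
    rw [Finset.prod_const, Finset.card_univ, Fintype.card_fin]
    congr 1
    refine Finset.prod_congr rfl fun l _ => ?_
    simp only [sourceSqDist, spanSqDist, hspan s hg]
    rfl

/-- A positive level of `s ↦ s ^ (2L) * criterion x (s • u)` is attained only on a null set: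
otherwise the function would be constant by analyticity, but it tends to zero at zero. -/
theorem volume_level_eq_zero (hL : 1 ≤ L) (x : Fin N → ℝ) (u : Fin L → ℝ) {C : ℝ} (hC : 0 < C)
    {S : Set ℝ} (hS : ∀ s ∈ S, s ^ (2 * L) * criterion x (s • u) = C) :
    MeasureTheory.volume S = 0 := by
  obtain ⟨g, k, hg, hk, ⟨s₀, hs₀⟩, hgk⟩ := exists_analytic_quotient x u
  have hg0 := ae_ne_zero_of_analytic hg hs₀
  set f : ℝ → ℂ := fun s => (s : ℂ) ^ (2 * L) * k s - C * g s with hf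
  have hfa : ∀ s, AnalyticAt ℝ f s := fun s =>
    ((((Complex.ofRealCLM.analyticAt s).pow _).mul (hk s)).sub (analyticAt_const.mul (hg s)))
  have hfs : ∀ s, g s ≠ 0 →
      f s = g s * ((s ^ (2 * L) * criterion x (s • u) - C : ℝ) : ℂ) := fun s hs => by
    simp only [hf, ← hgk s hs]; push_cast; ring
  by_cases hf0 : ∃ s, f s ≠ 0
  · obtain ⟨s₁, hs₁⟩ := hf0
    have := ae_ne_zero_of_analytic hfa hs₁
    refine MeasureTheory.measure_mono_null (fun s hs => ?_)
      (MeasureTheory.ae_iff.1 (this.and hg0))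
    rintro ⟨h1, h2⟩
    exact h1 (by rw [hfs s h2, hS s hs, sub_self]; simp)
  · -- otherwise the level is attained wherever `g` does not vanish, also arbitrarily close to zero
    push Not at hf0
    exfalso
    have hlim : Filter.Tendsto (fun s : ℝ => s ^ (2 * L) * (∑ n, x n ^ 2) ^ L) (nhds 0)
        (nhds 0) := by
      have : Continuous fun s : ℝ => s ^ (2 * L) * (∑ n, x n ^ 2) ^ L := by fun_prop
      simpa [show L ≠ 0 by omega] using this.tendsto 0
    obtain ⟨V, hV, hVo, hV0⟩ := mem_nhds_iff.1 (hlim.eventually (gt_mem_nhds hC))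
    obtain ⟨s, hsg, hsV⟩ := (MeasureTheory.Measure.dense_of_ae hg0).exists_mem_open hVo ⟨0, hV0⟩
    have h1 : s ^ (2 * L) * criterion x (s • u) - C = 0 := by
      have h := hfs s hsg
      rw [hf0 s] at h
      exact_mod_cast (mul_eq_zero.1 h.symm).resolve_left hsg
    have h2 : s ^ (2 * L) * (∑ n, x n ^ 2) ^ L < C := hV hsV
    have h3 : s ^ (2 * L) * criterion x (s • u) ≤ s ^ (2 * L) * (∑ n, x n ^ 2) ^ L := by
      have : 0 ≤ s ^ (2 * L) := by rw [pow_mul]; positivity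
      gcongr
      exact criterion_le _ _
    linarith

end Analytic

/-! ### Dilatable designs are almost never optimal -/

theorem isCompact_fasPositions (N : ℕ) (D : ℝ) : IsCompact (fasPositions N D) := by
  have : fasPositions N D = Set.univ.pi fun _ => Set.Icc 0 D := by
    ext p; simp only [fasPositions, Set.mem_univ_pi]; rfl
  rw [this]
  exact isCompact_univ_pi fun _ => isCompact_Icc

/-- Directions for which `x` is optimal, with positive value, among the designs in `[0, D]`. -/
def optimalDirections (L : ℕ) (x : Fin N → ℝ) (D : ℝ) : Set (Fin L → ℝ) :=
  {u | 0 < criterion x u ∧ ∀ q ∈ fasPositions N D, criterion q u ≤ criterion x u}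

theorem measurableSet_optimalDirections (x : Fin N → ℝ) (D : ℝ) :
    MeasurableSet (optimalDirections L x D) := by
  have hlt : ∀ r : ℝ, MeasurableSet {u : Fin L → ℝ | criterion x u < r} := fun r =>
    ((isOpen_criterion_lt r).preimage (by fun_prop : Continuous fun u => (x, u))).measurableSet
  have hall : ∀ r : ℝ, MeasurableSet {u : Fin L → ℝ | ∀ q ∈ fasPositions N D, criterion q u < r} :=
    fun r => (isOpen_forall_criterion_lt (isCompact_fasPositions N D) r).measurableSet
  have hpos : MeasurableSet {u : Fin L → ℝ | 0 < criterion x u} := by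
    have hm : Measurable fun u : Fin L → ℝ => criterion x u := measurable_of_Iio hlt
    exact measurableSet_lt measurable_const hm
  -- separating values by rationals reduces the comparison with all designs to open conditions
  have heq : optimalDirections L x D = {u | 0 < criterion x u} ∩
      (⋃ r : ℚ, {u | criterion x u < r} ∩
        {u : Fin L → ℝ | ∀ q ∈ fasPositions N D, criterion q u < (r : ℝ)}ᶜ)ᶜ := by
    ext u
    constructor
    · rintro ⟨h1, h2⟩
      refine ⟨h1, fun h => ?_⟩
      obtain ⟨r, hr1, hr2⟩ := Set.mem_iUnion.1 h
      exact hr2 fun q hq => (h2 q hq).trans_lt hr1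
    · rintro ⟨h1, h2⟩
      refine ⟨h1, fun q hq => ?_⟩
      by_contra! hlt
      obtain ⟨r, hr1, hr2⟩ := exists_rat_btwn hlt
      exact h2 (Set.mem_iUnion.2 ⟨r, hr1, fun h => (h q hq).not_gt hr2⟩)
  rw [heq]
  exact hpos.inter (MeasurableSet.iUnion fun r : ℚ => (hlt r).inter (hall r).compl).compl

/-- A design that leaves room for a dilation is optimal for almost no directions. On each ray of
directions, two directions for which it is optimal lie on the same level of
`volume_level_eq_zero`; integrating over the dilation factor, the set of such directions is null. -/
theorem volume_optimalDirections_eq_zero (hL : 1 ≤ L) {x : Fin N → ℝ} {D ρ : ℝ} (hρ : 1 < ρ)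
    (hx0 : ∀ n, 0 ≤ x n) (hxD : ∀ n, ρ * x n ≤ D) :
    MeasureTheory.volume (optimalDirections L x D) = 0 := by
  set E := optimalDirections L x D with hE
  have hEm : MeasurableSet E := measurableSet_optimalDirections x D
  -- optimality at `s • u` is tested against the design dilated by `t / s`
  have hle : ∀ u : Fin L → ℝ, ∀ s ∈ Set.Icc 1 ρ, ∀ t ∈ Set.Icc 1 ρ, s • u ∈ E →
      t ^ (2 * L) * criterion x (t • u) ≤ s ^ (2 * L) * criterion x (s • u) := by
    intro u s hs t ht hsE
    have hs0 : 0 < s := by linarith [hs.1]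
    have ht0 : 0 < t := by linarith [ht.1]
    have hmem : (t / s) • x ∈ fasPositions N D := fun n => by
      have h1 : t / s ≤ ρ := (div_le_self ht0.le hs.1).trans ht.2
      exact ⟨mul_nonneg (by positivity) (hx0 n),
        (mul_le_mul_of_nonneg_right h1 (hx0 n)).trans (hxD n)⟩
    have h := hsE.2 _ hmem
    rw [criterion_smul (by positivity), smul_smul, div_mul_cancel₀ _ hs0.ne', div_pow,
      div_mul_eq_mul_div, div_le_iff₀ (by positivity)] at h
    linarith
  -- on each ray the directions in `E` lie on a single level set, that of any one of them
  have hray : ∀ u : Fin L → ℝ, ∀ᵐ s ∂MeasureTheory.volume.restrict (Set.Icc 1 ρ), ¬ s • u ∈ E := by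
    intro u
    rw [MeasureTheory.ae_restrict_iff' measurableSet_Icc, MeasureTheory.ae_iff]
    have hset : {s : ℝ | ¬ (s ∈ Set.Icc 1 ρ → ¬ s • u ∈ E)} =
        {s | s ∈ Set.Icc 1 ρ ∧ s • u ∈ E} := by ext s; simp [and_assoc]
    rw [hset]
    rcases Set.eq_empty_or_nonempty {s : ℝ | s ∈ Set.Icc 1 ρ ∧ s • u ∈ E} with h | ⟨s₀, h₀, h₀E⟩
    · rw [h]; exact MeasureTheory.measure_empty
    · have hs₀ : 0 < s₀ := by linarith [h₀.1]
      refine volume_level_eq_zero hL x u (C := s₀ ^ (2 * L) * criterion x (s₀ • u))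
        (mul_pos (by positivity) h₀E.1) ?_
      rintro s ⟨hs, hsE⟩
      exact le_antisymm (hle u s₀ h₀ s hs h₀E) (hle u s hs s₀ h₀ hsE)
  have hmeas : MeasurableSet {z : (Fin L → ℝ) × ℝ | ¬ z.2 • z.1 ∈ E} :=
    (hEm.preimage (by fun_prop : Measurable fun z : (Fin L → ℝ) × ℝ => z.2 • z.1)).compl
  have hcomm := (MeasureTheory.Measure.ae_ae_comm (μ := MeasureTheory.volume)
    (ν := MeasureTheory.volume.restrict (Set.Icc 1 ρ))
    (p := fun (u : Fin L → ℝ) (s : ℝ) => ¬ s • u ∈ E) hmeas).1 (Filter.Eventually.of_forall hray)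
  have hne : (MeasureTheory.ae (MeasureTheory.volume.restrict (Set.Icc 1 ρ))).NeBot := by
    rw [MeasureTheory.ae_neBot, Ne, MeasureTheory.Measure.restrict_eq_zero, Real.volume_Icc]
    simpa using hρ
  obtain ⟨s, hs, hsI⟩ := (hcomm.and (MeasureTheory.ae_restrict_mem measurableSet_Icc)).exists
  have hs0 : s ≠ 0 := by linarith [hsI.1]
  have h1 : MeasureTheory.volume ((fun u : Fin L → ℝ => s • u) ⁻¹' E) = 0 := by
    have h := MeasureTheory.ae_iff.1 hs
    simp only [not_not] at h
    exact h
  rw [MeasureTheory.Measure.addHaar_preimage_smul _ hs0] at h1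
  refine (mul_eq_zero.1 h1).resolve_left ?_
  rw [ENNReal.ofReal_eq_zero, not_le]
  exact abs_pos.2 (inv_ne_zero (pow_ne_zero _ hs0))

theorem sin_mem_Ioo {θ : Fin L → ℝ} (hθ : IsDOA θ) (l : Fin L) :
    Real.sin (θ l) ∈ Set.Ioo (-1 : ℝ) 1 := by
  have h := hθ.2 l
  have h1 := Real.strictMonoOn_sin ⟨le_rfl, by linarith [h.1, h.2]⟩ ⟨h.1.le, h.2.le⟩ h.1
  have h2 := Real.strictMonoOn_sin ⟨h.1.le, h.2.le⟩ ⟨by linarith [h.1, h.2], le_rfl⟩ h.2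
  simpa using And.intro h1 h2

/-- The change of variables from direction sines back to angles preserves null sets. -/
theorem volume_angles_eq_zero {E : Set (Fin L → ℝ)} (hE : MeasureTheory.volume E = 0) :
    MeasureTheory.volume
      {θ : Fin L → ℝ | IsDOA θ ∧ (fun l => Real.sin (θ l)) ∈ E} = 0 := by
  set E' := E ∩ {u | ∀ l, u l ∈ Set.Ioo (-1 : ℝ) 1} with hE'
  have hd : DifferentiableOn ℝ (fun (u : Fin L → ℝ) l => Real.arcsin (u l)) E' := by
    rw [differentiableOn_pi]
    intro l u hu
    have h := hu.2 l
    have h1 : DifferentiableAt ℝ Real.arcsin (u l) :=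
      Real.differentiableAt_arcsin.2 ⟨h.1.ne', h.2.ne⟩
    exact (h1.comp (f := fun u : Fin L → ℝ => u l) u
      (differentiableAt_apply l u)).differentiableWithinAt
  have h0 := MeasureTheory.addHaar_image_eq_zero_of_differentiableOn_of_addHaar_eq_zero
    MeasureTheory.volume hd (MeasureTheory.measure_mono_null Set.inter_subset_left hE)
  refine MeasureTheory.measure_mono_null ?_ h0
  rintro θ ⟨hθ, hu⟩
  refine ⟨fun l => Real.sin (θ l), ⟨hu, fun l => sin_mem_Ioo hθ l⟩, ?_⟩
  funext l
  exact Real.arcsin_sin (hθ.2 l).1.le (hθ.2 l).2.le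

/-! ### Test designs -/

/-- Any weights annihilating all steering vectors bound the squared distances from below. -/
theorem norm_sum_sq_le_sourceSqDist (x : Fin N → ℝ) (u : Fin L → ℝ) (w : Fin N → ℂ)
    (hw : ∀ k, ∑ n, w n * Complex.exp (Complex.I * ((Real.pi * x n * u k : ℝ) : ℂ)) = 0)
    (l : Fin L) :
    ‖∑ n, w n * (x n * Complex.exp (Complex.I * ((Real.pi * x n * u l : ℝ) : ℂ)))‖ ^ 2 ≤
      (∑ n, ‖w n‖ ^ 2) * sourceSqDist x u l := by
  set w' : EuclideanSpace ℂ (Fin N) := WithLp.toLp 2 fun n => star (w n) with hw'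
  have hin : ∀ y : EuclideanSpace ℂ (Fin N), inner ℂ w' y = ∑ n, w n * y.ofLp n := fun y => by
    simp [hw', PiLp.inner_apply, mul_comm]
  have h := norm_inner_sq_le_spanSqDist (fun k => steeringVec x (u k)) (weightedVec x (u l)) w'
    fun k => by rw [hin]; exact hw k
  rw [hin, EuclideanSpace.norm_sq_eq] at h
  simpa [hw', weightedVec, sourceSqDist] using h

/-- The phase increment of the steering vector with direction sine `s` over one grid step. -/
def gridPhase (s : ℝ) : ℂ := Complex.exp (Complex.I * ((Real.pi * s : ℝ) : ℂ))

theorem exp_natCast_eq_gridPhase_pow (n : ℕ) (s : ℝ) :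
    Complex.exp (Complex.I * ((Real.pi * (n : ℝ) * s : ℝ) : ℂ)) = gridPhase s ^ n := by
  rw [gridPhase, ← Complex.exp_nat_mul]; push_cast; ring_nf

theorem gridPhase_ne_zero (s : ℝ) : gridPhase s ≠ 0 := Complex.exp_ne_zero _

/-- At half-wavelength spacing distinct directions have distinct phase increments. -/
theorem gridPhase_sin_injective {θ : Fin L → ℝ} (hθ : IsDOA θ) :
    Function.Injective fun l => gridPhase (Real.sin (θ l)) := by
  intro i j hij
  have him : ∀ s : ℝ, (Complex.I * ((Real.pi * s : ℝ) : ℂ)).im = Real.pi * s := fun s => by simp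
  have hb : ∀ l, -Real.pi < Real.pi * Real.sin (θ l) ∧ Real.pi * Real.sin (θ l) ≤ Real.pi :=
    fun l => by
      constructor <;> nlinarith [Real.pi_pos, (sin_mem_Ioo hθ l).1, (sin_mem_Ioo hθ l).2]
  have h := Complex.exp_inj_of_neg_pi_lt_of_le_pi (by rw [him]; exact (hb i).1)
    (by rw [him]; exact (hb i).2) (by rw [him]; exact (hb j).1) (by rw [him]; exact (hb j).2) hij
  have h2 : Real.pi * Real.sin (θ i) = Real.pi * Real.sin (θ j) := by
    rw [← him, h, him]
  have h3 := mul_left_cancel₀ Real.pi_ne_zero h2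
  exact hθ.1 (Real.strictMonoOn_sin.injOn ⟨(hθ.2 i).1.le, (hθ.2 i).2.le⟩
    ⟨(hθ.2 j).1.le, (hθ.2 j).2.le⟩ h3)

/-- Grid design with elements at `0, 1, …, L` and the remaining ones stacked at `L`. -/
def stackedGrid (N L : ℕ) : Fin N → ℝ := fun n => ((min (n : ℕ) L : ℕ) : ℝ)

/-- The coefficients of `Q = ∏ (X - z_k)` annihilate the steering vectors of the stacked grid, and
pair with the weighted steering vector of source `l` to `z_l * Q'(z_l) ≠ 0`. -/
theorem criterion_stackedGrid_pos (hL : 1 ≤ L) (hN : L < N) {u : Fin L → ℝ}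
    (hu : Function.Injective fun l => gridPhase (u l)) :
    0 < criterion (stackedGrid N L) u := by
  set z : Fin L → ℂ := fun l => gridPhase (u l) with hz
  set Q : Polynomial ℂ := Lagrange.nodal Finset.univ z with hQ
  have hdeg : Q.natDegree = L := by rw [hQ, Lagrange.natDegree_nodal]; simp
  have hexp : ∀ (n : Fin N) (s : ℝ), Q.coeff n *
      Complex.exp (Complex.I * ((Real.pi * stackedGrid N L n * s : ℝ) : ℂ)) =
      Q.coeff n * gridPhase s ^ (n : ℕ) := fun n s => by
    rcases le_or_gt (n : ℕ) L with h | h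
    · rw [stackedGrid, min_eq_left h, exp_natCast_eq_gridPhase_pow]
    · rw [Polynomial.coeff_eq_zero_of_natDegree_lt (by omega), zero_mul, zero_mul]
  have hann : ∀ k, ∑ n : Fin N, Q.coeff n *
      Complex.exp (Complex.I * ((Real.pi * stackedGrid N L n * u k : ℝ) : ℂ)) = 0 := fun k => by
    simp only [hexp]
    rw [Fin.sum_univ_eq_sum_range (fun n => Q.coeff n * gridPhase (u k) ^ n) N,
      ← Polynomial.eval_eq_sum_range' (p := Q) (by omega)]
    exact Lagrange.eval_nodal_at_node (v := z) (Finset.mem_univ k)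
  refine Finset.prod_pos fun l _ => ?_
  have h := norm_sum_sq_le_sourceSqDist (stackedGrid N L) u (fun n => Q.coeff n) hann l
  have hpair : ∑ n : Fin N, Q.coeff n * (stackedGrid N L n *
      Complex.exp (Complex.I * ((Real.pi * stackedGrid N L n * u l : ℝ) : ℂ))) =
      z l * (Polynomial.derivative Q).eval (z l) := by
    have hcoeff : ∀ n : ℕ, (Polynomial.X * Polynomial.derivative Q).coeff n = n * Q.coeff n := by
      rintro (_ | n)
      · simp
      · rw [Polynomial.coeff_X_mul, Polynomial.coeff_derivative]; push_cast; ring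
    have hd : (Polynomial.X * Polynomial.derivative Q).natDegree < N := by
      have h1 := Polynomial.natDegree_mul_le (p := Polynomial.X) (q := Polynomial.derivative Q)
      have h2 := Polynomial.natDegree_derivative_le Q
      have h3 := Polynomial.natDegree_X_le (R := ℂ)
      omega
    have heval : z l * (Polynomial.derivative Q).eval (z l) =
        (Polynomial.X * Polynomial.derivative Q).eval (z l) := by simp
    rw [heval, Polynomial.eval_eq_sum_range' hd (z l), Finset.sum_range]
    refine Finset.sum_congr rfl fun n _ => ?_
    rw [mul_left_comm, hexp, hcoeff]
    rcases le_or_gt (n : ℕ) L with h | h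
    · rw [stackedGrid, min_eq_left h]; push_cast; ring
    · rw [Polynomial.coeff_eq_zero_of_natDegree_lt (by omega)]; simp
  have hQ' : (Polynomial.derivative Q).eval (z l) ≠ 0 := by
    have h1 := Lagrange.nodalWeight_ne_zero (s := Finset.univ) (v := z) hu.injOn
      (Finset.mem_univ l)
    rw [Lagrange.nodalWeight_eq_eval_derivative_nodal (Finset.mem_univ l)] at h1
    exact fun h0 => h1 (by rw [h0, inv_zero])
  rw [hpair] at h
  have hpos : 0 < ‖z l * (Polynomial.derivative Q).eval (z l)‖ ^ 2 := by
    have := norm_pos_iff.2 (mul_ne_zero (gridPhase_ne_zero (u l)) hQ')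
    positivity
  exact pos_of_mul_pos_right (hpos.trans_le h) (by positivity)

theorem sum_fin_eq_of_eq_zero {M : Type*} [AddCommMonoid M] (hN : L < N) (F : ℕ → M)
    (hF : ∀ n, L < n → F n = 0) :
    ∑ n : Fin N, F n = ∑ n ∈ Finset.range L, F n + F L := by
  rw [Fin.sum_univ_eq_sum_range F N, ← Finset.sum_range_succ]
  refine (Finset.sum_subset (Finset.range_mono hN) fun n _ hn => hF n ?_).symm
  rw [Finset.mem_range] at hn
  omega

/-- The design with `L` elements at `0, …, L - 1` and the rest at distance `X`: the steering vectors
restricted to the first block are independent, so no bounded combination of them can reproduce the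
weight `X` of the remote elements, and all squared distances grow like `X ^ 2`. -/
theorem exists_design_growth (hN : L < N) {u : Fin L → ℝ}
    (hu : Function.Injective fun l => gridPhase (u l)) :
    ∃ c T : ℝ, 0 < c ∧ 0 < T ∧ ∀ X : ℝ, T ≤ X →
      ∃ x ∈ fasPositions N X, ∀ l, c * X ^ 2 ≤ sourceSqDist x u l := by
  set z : Fin L → ℂ := fun l => gridPhase (u l) with hz
  set b : ℕ → ℝ := fun n => ∑ k, ‖(Lagrange.basis Finset.univ z k).coeff n‖ with hb
  have hb0 : ∀ n, 0 ≤ b n := fun n => Finset.sum_nonneg fun _ _ => norm_nonneg _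
  set K₁ : ℝ := ∑ n ∈ Finset.range L, b n * n with hK₁
  set K₂ : ℝ := ∑ n ∈ Finset.range L, b n ^ 2 + 1 with hK₂
  have hK₁0 : 0 ≤ K₁ := Finset.sum_nonneg fun n _ => mul_nonneg (hb0 n) n.cast_nonneg
  have hK₂0 : 0 < K₂ := by
    have : 0 ≤ ∑ n ∈ Finset.range L, b n ^ 2 := Finset.sum_nonneg fun n _ => sq_nonneg _
    linarith
  refine ⟨1 / (4 * K₂), 2 * K₁ + L + 1, by positivity, by positivity, fun X hX => ?_⟩
  have hX0 : 0 ≤ X := by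
    have : (0 : ℝ) ≤ L := L.cast_nonneg
    linarith
  set ξ : ℕ → ℝ := fun n => if n < L then (n : ℝ) else X with hξ
  set e : Fin L → ℂ := fun k => Complex.exp (Complex.I * ((Real.pi * X * u k : ℝ) : ℂ)) with he
  have hen : ∀ k, ‖e k‖ = 1 := fun k => norm_exp_I_mul_ofReal _
  -- the Lagrange interpolant cancelling the phases of the remote elements
  set R : Polynomial ℂ := Lagrange.interpolate Finset.univ z fun k => -e k with hR
  have hRdeg : R.degree < L := by
    have h := Lagrange.degree_interpolate_lt (s := Finset.univ) (fun k => -e k) hu.injOn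
    rwa [Finset.card_univ, Fintype.card_fin] at h
  have hReval : ∀ k, ∑ n ∈ Finset.range L, R.coeff n * z k ^ n = -e k := fun k => by
    have hL : 0 < L := k.pos
    rw [← Polynomial.eval_eq_sum_range', Lagrange.eval_interpolate_at_node _ hu.injOn
      (Finset.mem_univ k)]
    rcases eq_or_ne R 0 with h | h
    · rw [h]; simpa using hL
    · exact (Polynomial.natDegree_lt_iff_degree_lt h).2 hRdeg
  have hRcoeff : ∀ n, ‖R.coeff n‖ ≤ b n := fun n => by
    rw [hR, Lagrange.interpolate_apply, Polynomial.finsetSum_coeff]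
    refine (norm_sum_le _ _).trans_eq (Finset.sum_congr rfl fun k _ => ?_)
    rw [Polynomial.coeff_C_mul, norm_mul, norm_neg, hen, one_mul]
  set w : ℕ → ℂ := fun n => if n < L then R.coeff n else if n = L then 1 else 0 with hw
  have hw1 : ∀ n ∈ Finset.range L, w n = R.coeff n := fun n hn => if_pos (Finset.mem_range.1 hn)
  have hwL : w L = 1 := by simp [hw]
  have hw0 : ∀ n, L < n → w n = 0 := fun n hn => by
    simp [hw, not_lt.2 hn.le, hn.ne']
  have hξ1 : ∀ n ∈ Finset.range L, ξ n = n := fun n hn => if_pos (Finset.mem_range.1 hn)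
  have hξL : ξ L = X := by simp [hξ]
  refine ⟨fun n => ξ n, fun n => ?_, fun l => ?_⟩
  · by_cases h : (n : ℕ) < L
    · have h1 : ξ n = n := if_pos h
      have h2 : ((n : ℕ) : ℝ) ≤ L := by exact_mod_cast h.le
      change ξ n ∈ Set.Icc 0 X
      rw [h1]
      exact ⟨Nat.cast_nonneg _, by linarith⟩
    · have h1 : ξ n = X := if_neg h
      change ξ n ∈ Set.Icc 0 X
      rw [h1]
      exact ⟨hX0, le_rfl⟩
  have hann : ∀ k, ∑ n : Fin N, w n *
      Complex.exp (Complex.I * ((Real.pi * ξ n * u k : ℝ) : ℂ)) = 0 := fun k => by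
    rw [sum_fin_eq_of_eq_zero hN
      (fun n => w n * Complex.exp (Complex.I * ((Real.pi * ξ n * u k : ℝ) : ℂ)))
      fun n hn => by rw [hw0 n hn, zero_mul], hwL, hξL, one_mul]
    have : ∑ n ∈ Finset.range L, w n *
        Complex.exp (Complex.I * ((Real.pi * ξ n * u k : ℝ) : ℂ)) = -e k := by
      rw [← hReval k]
      exact Finset.sum_congr rfl fun n hn => by
        rw [hw1 n hn, hξ1 n hn, exp_natCast_eq_gridPhase_pow]
    rw [this, he, neg_add_cancel]
  have h := norm_sum_sq_le_sourceSqDist (fun n : Fin N => ξ n) u (fun n => w n) hann l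
  have hw2 : ∑ n : Fin N, ‖w n‖ ^ 2 ≤ K₂ := by
    rw [sum_fin_eq_of_eq_zero hN (fun n => ‖w n‖ ^ 2) fun n hn => by simp [hw0 n hn], hwL, hK₂]
    have : ∑ n ∈ Finset.range L, ‖w n‖ ^ 2 ≤ ∑ n ∈ Finset.range L, b n ^ 2 :=
      Finset.sum_le_sum fun n hn => by
        rw [hw1 n hn]; exact pow_le_pow_left₀ (norm_nonneg _) (hRcoeff n) 2
    simpa using this
  have hpair : X - K₁ ≤ ‖∑ n : Fin N, w n *
      (ξ n * Complex.exp (Complex.I * ((Real.pi * ξ n * u l : ℝ) : ℂ)))‖ := by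
    rw [sum_fin_eq_of_eq_zero hN (fun n => w n *
      (ξ n * Complex.exp (Complex.I * ((Real.pi * ξ n * u l : ℝ) : ℂ))))
      fun n hn => by rw [hw0 n hn, zero_mul], hwL, hξL, one_mul]
    have h1 : ‖∑ n ∈ Finset.range L, w n *
        (ξ n * Complex.exp (Complex.I * ((Real.pi * ξ n * u l : ℝ) : ℂ)))‖ ≤ K₁ := by
      refine (norm_sum_le _ _).trans (Finset.sum_le_sum fun n hn => ?_)
      rw [norm_mul, norm_mul, norm_exp_I_mul_ofReal, mul_one, hw1 n hn, hξ1 n hn]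
      have : ‖((n : ℝ) : ℂ)‖ = n := by simp
      rw [this]
      gcongr
      exact hRcoeff n
    have h2 : ‖(X : ℂ) * Complex.exp (Complex.I * ((Real.pi * X * u l : ℝ) : ℂ))‖ = X := by
      rw [norm_mul, norm_exp_I_mul_ofReal, mul_one, Complex.norm_real, Real.norm_of_nonneg hX0]
    have h3 := norm_sub_le_norm_add
      ((X : ℂ) * Complex.exp (Complex.I * ((Real.pi * X * u l : ℝ) : ℂ)))
      (∑ n ∈ Finset.range L, w n *
        (ξ n * Complex.exp (Complex.I * ((Real.pi * ξ n * u l : ℝ) : ℂ))))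
    rw [add_comm] at h3
    linarith
  have hhalf : X / 2 ≤ X - K₁ := by
    have : (0 : ℝ) ≤ L := L.cast_nonneg
    linarith
  have h4 : (X / 2) ^ 2 ≤ K₂ * sourceSqDist (fun n : Fin N => ξ n) u l :=
    (pow_le_pow_left₀ (by positivity) (hhalf.trans hpair) 2).trans
      (h.trans (mul_le_mul_of_nonneg_right hw2 (sourceSqDist_nonneg _ _ _)))
  rw [div_mul_eq_mul_div, div_le_iff₀ (by positivity)]
  linarith

/-! ### Optimal designs and the gain -/

theorem hasDOptimal_of_max {lam σ : ℝ} {Np : ℕ} {P θ : Fin L → ℝ} {S : Set (Fin N → ℝ)}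
    {p : Fin N → ℝ} (hp : p ∈ S)
    (hmax : ∀ q ∈ S, (fim lam σ Np P θ q).det ≤ (fim lam σ Np P θ p).det) :
    HasDOptimal lam σ Np P θ S := by
  refine ⟨p, hp, hmax, IsGreatest.csSup_eq ⟨⟨p, hp, rfl⟩, ?_⟩⟩
  rintro _ ⟨q, hq, rfl⟩
  exact hmax q hq

theorem hasDOptimal_of_finite {lam σ : ℝ} {Np : ℕ} {P θ : Fin L → ℝ} {S : Set (Fin N → ℝ)}
    (hfin : S.Finite) (hne : S.Nonempty) : HasDOptimal lam σ Np P θ S := by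
  obtain ⟨p, hp, hmax⟩ := Set.exists_max_image S (fun q => (fim lam σ Np P θ q).det) hfin hne
  exact hasDOptimal_of_max hp hmax

theorem div_mem_fasPositions {d₀ D : ℝ} (hd : 0 < d₀) {p : Fin N → ℝ}
    (hp : p ∈ fasPositions N D) : (fun n => p n / d₀) ∈ fasPositions N (D / d₀) := fun n =>
  ⟨div_nonneg (hp n).1 hd.le, div_le_div_of_nonneg_right (hp n).2 hd.le⟩

theorem mul_mem_fasPositions {d₀ D : ℝ} (hd : 0 < d₀) {x : Fin N → ℝ}
    (hx : x ∈ fasPositions N (D / d₀)) : (fun n => x n * d₀) ∈ fasPositions N D := fun n =>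
  ⟨mul_nonneg (hx n).1 hd.le, (le_div_iff₀ hd).1 (hx n).2⟩

theorem hasDOptimal_fasPositions {d₀ σ D : ℝ} {Np : ℕ} {P θ : Fin L → ℝ} (hd : 0 < d₀)
    (hscale : 0 < fimScale σ Np P θ) (hD : 0 ≤ D) :
    HasDOptimal (2 * d₀) σ Np P θ (fasPositions N D) := by
  have hne : (fasPositions N (D / d₀)).Nonempty := ⟨0, fun _ => ⟨le_rfl, by
    have : 0 ≤ D / d₀ := by positivity
    exact this⟩⟩
  obtain ⟨x, hx, hmax⟩ := UpperSemicontinuousOn.exists_isMaxOn hne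
    (isCompact_fasPositions N (D / d₀))
    ((upperSemicontinuous_criterion fun l => Real.sin (θ l)).upperSemicontinuousOn _)
  refine hasDOptimal_of_max (mul_mem_fasPositions hd hx) fun q hq => ?_
  rw [det_fim hd, det_fim hd]
  have h : (fun n => x n * d₀ / d₀) = x := funext fun n => mul_div_cancel_right₀ _ hd.ne'
  rw [h]
  exact mul_le_mul_of_nonneg_left (hmax (div_mem_fasPositions hd hq)) hscale.le

/-- An optimal determinant is the common scale times the largest value of the criterion. -/
theorem HasDOptimal.exists_criterion {d₀ σ : ℝ} {Np : ℕ} {P θ : Fin L → ℝ}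
    {S : Set (Fin N → ℝ)} (h : HasDOptimal (2 * d₀) σ Np P θ S) (hd : 0 < d₀)
    (hscale : 0 < fimScale σ Np P θ) :
    ∃ p ∈ S, optDet (2 * d₀) σ Np P θ S =
        fimScale σ Np P θ * criterion (fun n => p n / d₀) (fun l => Real.sin (θ l)) ∧
      ∀ q ∈ S, criterion (fun n => q n / d₀) (fun l => Real.sin (θ l)) ≤
        criterion (fun n => p n / d₀) (fun l => Real.sin (θ l)) := by
  obtain ⟨p, hp, hmax, heq⟩ := h
  refine ⟨p, hp, by rw [heq, det_fim hd], fun q hq => ?_⟩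
  have := hmax q hq
  rw [det_fim hd, det_fim hd] at this
  exact le_of_mul_le_mul_left this hscale

theorem gridPositions_subset (N : ℕ) (d₀ D : ℝ) : gridPositions N d₀ D ⊆ fasPositions N D :=
  fun _ hp n => (hp n).1

theorem classicalPositions_subset (κ : ℝ) (N : ℕ) (d₀ D : ℝ) :
    classicalPositions κ N d₀ D ⊆ gridPositions N d₀ D := fun _ hp => hp.1

theorem gridPositions_finite {N : ℕ} {d₀ : ℝ} (hd : 0 < d₀) (D : ℝ) :
    (gridPositions N d₀ D).Finite := by
  have hF : ((fun k : ℕ => (k : ℝ) * d₀) '' Set.Iic ⌊D / d₀⌋₊).Finite :=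
    (Set.finite_Iic _).image _
  refine (Set.Finite.pi' fun _ : Fin N => hF).subset fun p hp n => ?_
  obtain ⟨⟨-, h2⟩, k, hk⟩ := hp n
  refine ⟨k, Nat.le_floor ?_, hk.symm⟩
  rw [le_div_iff₀ hd, ← hk]
  exact h2

theorem le_aperture (hN : L < N) (hL : 1 ≤ L) {κ : ℝ} (hκ : 1 ≤ κ) :
    (L : ℝ) ≤ κ * ((N : ℝ) * ((N : ℝ) - 1) / 2) := by
  have h1 : (L : ℝ) + 1 ≤ N := by exact_mod_cast hN
  have h2 : (1 : ℝ) ≤ L := by exact_mod_cast hL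
  have h3 : (L : ℝ) ≤ (N : ℝ) * ((N : ℝ) - 1) / 2 := by nlinarith
  nlinarith

theorem stackedGrid_mem_classicalPositions (hN : L < N) (hL : 1 ≤ L) {κ d₀ D : ℝ} (hκ : 1 ≤ κ)
    (hd : 0 < d₀) (hD : L * d₀ ≤ D) :
    (fun n => stackedGrid N L n * d₀) ∈ classicalPositions κ N d₀ D := by
  have h0 : ∀ n, 0 ≤ stackedGrid N L n := fun n => Nat.cast_nonneg _
  have hle : ∀ n, stackedGrid N L n ≤ L := fun n => by
    unfold stackedGrid; exact_mod_cast min_le_right _ _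
  refine ⟨fun n => ⟨⟨mul_nonneg (h0 n) hd.le, ?_⟩, _, rfl⟩, fun i j => ?_⟩
  · exact (mul_le_mul_of_nonneg_right (hle n) hd.le).trans hD
  · rw [← sub_mul]
    refine mul_le_mul_of_nonneg_right ?_ hd.le
    linarith [h0 j, hle i, le_aperture hN hL hκ]

/-- A class of grid designs containing the stacked grid has an optimal design, of positive value,
and the gain over it is at least one. -/
theorem optimal_of_stackedGrid_mem (hL : 1 ≤ L) (hN : L < N) {d₀ σ D : ℝ} {Np : ℕ}
    {P θ : Fin L → ℝ} {S : Set (Fin N → ℝ)} (hd : 0 < d₀) (hscale : 0 < fimScale σ Np P θ)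
    (hD : 0 ≤ D) (hθ : IsDOA θ) (hS : S ⊆ gridPositions N d₀ D)
    (hmem : (fun n => stackedGrid N L n * d₀) ∈ S) :
    HasDOptimal (2 * d₀) σ Np P θ S ∧ 0 < optDet (2 * d₀) σ Np P θ S ∧
      1 ≤ gain d₀ σ Np P θ D S := by
  have hopt : HasDOptimal (2 * d₀) σ Np P θ S :=
    hasDOptimal_of_finite ((gridPositions_finite hd D).subset hS) ⟨_, hmem⟩
  obtain ⟨p, hp, hpv, hpmax⟩ := hopt.exists_criterion hd hscale
  have hpos : 0 < optDet (2 * d₀) σ Np P θ S := by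
    have h := hpmax _ hmem
    have hst : (fun n => stackedGrid N L n * d₀ / d₀) = stackedGrid N L :=
      funext fun n => mul_div_cancel_right₀ _ hd.ne'
    rw [hst] at h
    rw [hpv]
    exact mul_pos hscale ((criterion_stackedGrid_pos hL hN (gridPhase_sin_injective hθ)).trans_le h)
  refine ⟨hopt, hpos, ?_⟩
  obtain ⟨q, hq, hqv, hqmax⟩ :=
    (hasDOptimal_fasPositions (N := N) hd hscale hD).exists_criterion hd hscale
  rw [gain, one_le_div hpos, hpv, hqv]
  exact mul_le_mul_of_nonneg_left (hqmax p (gridPositions_subset _ _ _ (hS hp))) hscale.le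

/-- If the designs of the class all have aperture at most `M < D`, each can be translated to
the origin and then dilated, so almost surely none of them is optimal among continuous designs. -/
theorem ae_one_lt_gain (hL : 1 ≤ L) (hN : L < N) {d₀ σ D M : ℝ} {Np : ℕ}
    {P : Fin L → ℝ} {S : Set (Fin N → ℝ)} (hd : 0 < d₀)
    (hscale : ∀ θ : Fin L → ℝ, IsDOA θ → 0 < fimScale σ Np P θ)
    (hS : S ⊆ gridPositions N d₀ D) (hmem : (fun n => stackedGrid N L n * d₀) ∈ S)
    (hM : 0 < M) (hMD : M < D) (hap : ∀ p ∈ S, ∃ a, ∀ n, 0 ≤ p n - a ∧ p n - a ≤ M) :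
    ∀ᵐ θ : Fin L → ℝ, IsDOA θ → 1 < gain d₀ σ Np P θ D S := by
  choose! a ha using hap
  set x : (Fin N → ℝ) → Fin N → ℝ := fun p n => p n / d₀ + -(a p / d₀) with hx
  have hxe : ∀ p n, x p n = (p n - a p) / d₀ := fun p n => by simp only [hx]; ring
  have hnull : ∀ p ∈ S, ∀ᵐ θ : Fin L → ℝ,
      ¬ (IsDOA θ ∧ (fun l => Real.sin (θ l)) ∈ optimalDirections L (x p) (D / d₀)) := by
    intro p hp
    rw [MeasureTheory.ae_iff]
    simp only [not_not]
    refine volume_angles_eq_zero (volume_optimalDirections_eq_zero hL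
      (ρ := D / M) ((one_lt_div hM).2 hMD) (fun n => ?_) fun n => ?_)
    · rw [hxe]; exact div_nonneg (ha p hp n).1 hd.le
    · have h0 : 0 ≤ D / M := (div_pos (hM.trans hMD) hM).le
      have h1 : D / M * (p n - a p) ≤ D :=
        (mul_le_mul_of_nonneg_left (ha p hp n).2 h0).trans_eq (div_mul_cancel₀ _ hM.ne')
      rw [hxe, ← mul_div_assoc]
      exact div_le_div_of_nonneg_right h1 hd.le
  have hfin := (gridPositions_finite hd D).subset hS
  filter_upwards [(MeasureTheory.ae_ball_iff hfin.countable).2 hnull] with θ h hθ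
  have hsc := hscale θ hθ
  obtain ⟨hopt, hpos, -⟩ := optimal_of_stackedGrid_mem hL hN hd hsc (hM.trans hMD).le hθ hS hmem
  obtain ⟨p, hp, hpv, -⟩ := hopt.exists_criterion hd hsc
  obtain ⟨q, hq, hqv, hqmax⟩ := (hasDOptimal_fasPositions (N := N) hd hsc
    (hM.trans hMD).le).exists_criterion hd hsc
  have hxp : criterion (x p) (fun l => Real.sin (θ l)) =
      criterion (fun n => p n / d₀) (fun l => Real.sin (θ l)) := criterion_add _ _ _
  have hcp : 0 < criterion (fun n => p n / d₀) (fun l => Real.sin (θ l)) := by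
    rw [hpv] at hpos
    exact (mul_pos_iff_of_pos_left hsc).1 hpos
  have hnot := h p hp
  obtain ⟨y, hy, hlt⟩ : ∃ y ∈ fasPositions N (D / d₀),
      criterion (x p) (fun l => Real.sin (θ l)) < criterion y (fun l => Real.sin (θ l)) := by
    by_contra! hcon
    exact hnot ⟨hθ, by rw [hxp]; exact hcp, hcon⟩
  have hyq := hqmax _ (mul_mem_fasPositions hd hy)
  have hye : (fun n => y n * d₀ / d₀) = y := funext fun n => mul_div_cancel_right₀ _ hd.ne'
  rw [hye] at hyq
  rw [gain, one_lt_div hpos, hpv, hqv]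
  exact mul_lt_mul_of_pos_left ((hxp ▸ hlt).trans_le hyq) hsc

theorem exists_translate_of_mem_classicalPositions (hN : 0 < N) {κ d₀ D : ℝ} {p : Fin N → ℝ}
    (hp : p ∈ classicalPositions κ N d₀ D) :
    ∃ a, ∀ n, 0 ≤ p n - a ∧ p n - a ≤ κ * ((N : ℝ) * ((N : ℝ) - 1) / 2) * d₀ := by
  have : Nonempty (Fin N) := ⟨⟨0, hN⟩⟩
  obtain ⟨j, hj⟩ := Finite.exists_min p
  exact ⟨p j, fun n => ⟨sub_nonneg.2 (hj n), hp.2 n j⟩⟩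

theorem criterion_le_of_mem_Icc {x : Fin N → ℝ} {B : ℝ} (h : ∀ n, 0 ≤ x n ∧ x n ≤ B)
    (u : Fin L → ℝ) : criterion x u ≤ (N : ℝ) ^ L * B ^ (2 * L) := by
  refine (criterion_le x u).trans ?_
  have h1 : ∑ n, x n ^ 2 ≤ N * B ^ 2 := by
    refine (Finset.sum_le_sum fun n _ => pow_le_pow_left₀ (h n).1 (h n).2 2).trans_eq ?_
    simp
  calc (∑ n, x n ^ 2) ^ L ≤ (N * B ^ 2) ^ L :=
        pow_le_pow_left₀ (Finset.sum_nonneg fun n _ => sq_nonneg _) h1 L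
    _ = (N : ℝ) ^ L * B ^ (2 * L) := by rw [mul_pow, pow_mul]

end FAS

end

theorem mainTheorem4 (L N : ℕ) (hL : 1 ≤ L) (hN : L < N) (κ : ℝ) (hκ : 1 ≤ κ) :
    -- (i) the optima exist, the denominators are positive, and the gain is at least one
    (∀ (d₀ σ D : ℝ) (Np : ℕ) (P θ : Fin L → ℝ),
      0 < d₀ → 0 < σ → 1 ≤ Np → (∀ l, 0 < P l) → L * d₀ ≤ D → FAS.IsDOA θ →
      FAS.HasDOptimal (2 * d₀) σ Np P θ (FAS.fasPositions N D) ∧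
      (∀ S ∈ ({FAS.gridPositions N d₀ D, FAS.classicalPositions κ N d₀ D} :
          Set (Set (Fin N → ℝ))),
        FAS.HasDOptimal (2 * d₀) σ Np P θ S ∧
        0 < FAS.optDet (2 * d₀) σ Np P θ S ∧
        1 ≤ FAS.gain d₀ σ Np P θ D S)) ∧
    -- (ii) the gain exceeds one for almost every angle vector
    (∀ (d₀ σ D : ℝ) (Np : ℕ) (P : Fin L → ℝ),
      0 < d₀ → 0 < σ → 1 ≤ Np → (∀ l, 0 < P l) → L * d₀ ≤ D →
      ((¬ ∃ k : ℕ, D = k * d₀) →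
        ∀ᵐ θ : Fin L → ℝ, FAS.IsDOA θ →
          1 < FAS.gain d₀ σ Np P θ D (FAS.gridPositions N d₀ D)) ∧
      (((¬ ∃ k : ℕ, D = k * d₀) ∨ κ * ((N : ℝ) * ((N : ℝ) - 1) / 2) * d₀ < D) →
        ∀ᵐ θ : Fin L → ℝ, FAS.IsDOA θ →
          1 < FAS.gain d₀ σ Np P θ D (FAS.classicalPositions κ N d₀ D))) ∧
    -- (iii) growth of the gain over classical grid arrays as the region grows
    (∀ θ : Fin L → ℝ, FAS.IsDOA θ →
      ∃ c C T : ℝ, 0 < c ∧ 0 < C ∧ 0 < T ∧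
        ∀ (d₀ σ D : ℝ) (Np : ℕ) (P : Fin L → ℝ),
          0 < d₀ → 0 < σ → 1 ≤ Np → (∀ l, 0 < P l) → T * d₀ ≤ D →
          c * (D ^ (2 * L) / ((N : ℝ) ^ (2 * L) * ((N : ℝ) - 1) ^ (2 * L) * d₀ ^ (2 * L))) ≤
              FAS.gain d₀ σ Np P θ D (FAS.classicalPositions κ N d₀ D) ∧
          FAS.gain d₀ σ Np P θ D (FAS.classicalPositions κ N d₀ D) ≤
            C * (D ^ (2 * L) / ((N : ℝ) ^ (2 * L) * ((N : ℝ) - 1) ^ (2 * L) * d₀ ^ (2 * L)))) := by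
  have hN1 : (1 : ℝ) ≤ L := by exact_mod_cast hL
  have hN2 : (L : ℝ) + 1 ≤ N := by exact_mod_cast hN
  have hA := FAS.le_aperture hN hL hκ
  set A : ℝ := κ * ((N : ℝ) * ((N : ℝ) - 1) / 2) with hAdef
  refine ⟨?_, ?_, ?_⟩
  · intro d₀ σ D Np P θ hd hσ hNp hP hD hθ
    have hsc := FAS.fimScale_pos hσ hNp hP hθ
    have hD0 : 0 ≤ D := (by positivity : 0 ≤ (L : ℝ) * d₀).trans hD
    have hmem := FAS.stackedGrid_mem_classicalPositions hN hL hκ hd hD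
    refine ⟨FAS.hasDOptimal_fasPositions hd hsc hD0, ?_⟩
    rintro S (rfl | rfl)
    · exact FAS.optimal_of_stackedGrid_mem hL hN hd hsc hD0 hθ subset_rfl hmem.1
    · exact FAS.optimal_of_stackedGrid_mem hL hN hd hsc hD0 hθ
        (FAS.classicalPositions_subset _ _ _ _) hmem
  · intro d₀ σ D Np P hd hσ hNp hP hD
    have hD0 : 0 ≤ D := (by positivity : 0 ≤ (L : ℝ) * d₀).trans hD
    have hsc : ∀ θ : Fin L → ℝ, FAS.IsDOA θ → 0 < FAS.fimScale σ Np P θ := fun θ hθ =>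
      FAS.fimScale_pos hσ hNp hP hθ
    have hmem := FAS.stackedGrid_mem_classicalPositions hN hL hκ hd hD
    -- off the lattice, every grid design stops at the last grid point before `D`
    have hoff : (¬ ∃ k : ℕ, D = k * d₀) → ∀ S ⊆ FAS.gridPositions N d₀ D,
        (fun n => FAS.stackedGrid N L n * d₀) ∈ S →
        ∀ᵐ θ : Fin L → ℝ, FAS.IsDOA θ → 1 < FAS.gain d₀ σ Np P θ D S := by
      intro hk S hS hmemS
      have hfloor : (⌊D / d₀⌋₊ : ℝ) * d₀ ≤ D :=
        (le_div_iff₀ hd).1 (Nat.floor_le (div_nonneg hD0 hd.le))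
      have hLfloor : L ≤ ⌊D / d₀⌋₊ := Nat.le_floor ((le_div_iff₀ hd).2 hD)
      refine FAS.ae_one_lt_gain hL hN (M := (⌊D / d₀⌋₊ : ℝ) * d₀) hd hsc hS hmemS
        (mul_pos (by exact_mod_cast hL.trans hLfloor) hd)
        (lt_of_le_of_ne hfloor fun h => hk ⟨_, h.symm⟩) fun p hp => ⟨0, fun n => ?_⟩
      obtain ⟨⟨h0, h1⟩, k, hpk⟩ := hS hp n
      refine ⟨by simpa using h0, ?_⟩
      rw [sub_zero, hpk]
      refine mul_le_mul_of_nonneg_right ?_ hd.le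
      exact_mod_cast Nat.le_floor ((le_div_iff₀ hd).2 (hpk ▸ h1))
    refine ⟨fun hk => hoff hk _ subset_rfl hmem.1, ?_⟩
    rintro (hk | hlt)
    · exact hoff hk _ (FAS.classicalPositions_subset _ _ _ _) hmem
    · exact FAS.ae_one_lt_gain hL hN hd hsc (FAS.classicalPositions_subset _ _ _ _) hmem
        (mul_pos (by linarith) hd) hlt fun p hp =>
          FAS.exists_translate_of_mem_classicalPositions (by omega) hp
  · intro θ hθ
    set u : Fin L → ℝ := fun l => Real.sin (θ l) with hu
    have hinj := FAS.gridPhase_sin_injective hθ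
    have hm := FAS.criterion_stackedGrid_pos hL hN hinj
    set m := FAS.criterion (FAS.stackedGrid N L) u with hmdef
    obtain ⟨c, T, hc, hT, hgrow⟩ := FAS.exists_design_growth hN hinj
    set W : ℝ := (N : ℝ) ^ (2 * L) * ((N : ℝ) - 1) ^ (2 * L) with hW
    have hN0 : (0 : ℝ) < N := by linarith
    have hN10 : (0 : ℝ) < (N : ℝ) - 1 := by linarith
    have hW0 : 0 < W := by positivity
    have hA0 : 0 < A := by linarith
    set B : ℝ := (N : ℝ) ^ L * A ^ (2 * L) with hB
    have hB0 : 0 < B := by positivity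
    refine ⟨c ^ L * W / B, (N : ℝ) ^ L * W / m, T + L, by positivity, by positivity,
      by positivity, fun d₀ σ D Np P hd hσ hNp hP hTD => ?_⟩
    have hsc := FAS.fimScale_pos hσ hNp hP hθ
    have hLD : (L : ℝ) * d₀ ≤ D :=
      (mul_le_mul_of_nonneg_right (by linarith) hd.le).trans hTD
    have hD0 : 0 ≤ D := (by positivity : 0 ≤ (L : ℝ) * d₀).trans hLD
    have hTX : T ≤ D / d₀ := (le_div_iff₀ hd).2
      ((mul_le_mul_of_nonneg_right (by linarith) hd.le).trans hTD)
    have hmem := FAS.stackedGrid_mem_classicalPositions hN hL hκ hd hLD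
    obtain ⟨hopt, -, -⟩ := FAS.optimal_of_stackedGrid_mem hL hN hd hsc hD0 hθ
      (FAS.classicalPositions_subset κ _ _ _) hmem
    obtain ⟨p, hp, hpv, hpmax⟩ := hopt.exists_criterion hd hsc
    obtain ⟨q, hq, hqv, hqmax⟩ :=
      (FAS.hasDOptimal_fasPositions (N := N) hd hsc hD0).exists_criterion hd hsc
    have hcancel : ∀ x : Fin N → ℝ, (fun n => x n * d₀ / d₀) = x := fun x =>
      funext fun n => mul_div_cancel_right₀ _ hd.ne'
    set Hp := FAS.criterion (fun n => p n / d₀) u with hHp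
    set Hq := FAS.criterion (fun n => q n / d₀) u with hHq
    have hmp : m ≤ Hp := by
      have h := hpmax _ hmem
      rwa [hcancel] at h
    have hpB : Hp ≤ B := by
      obtain ⟨a, ha⟩ := FAS.exists_translate_of_mem_classicalPositions (by omega) hp
      rw [hHp, ← FAS.criterion_add (-(a / d₀))]
      refine FAS.criterion_le_of_mem_Icc (fun n => ?_) u
      have h : p n / d₀ + -(a / d₀) = (p n - a) / d₀ := by ring
      rw [h, div_le_iff₀ hd]
      exact ⟨div_nonneg (ha n).1 hd.le, (ha n).2⟩
    have hqlow : c ^ L * (D / d₀) ^ (2 * L) ≤ Hq := by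
      obtain ⟨x, hx, hxc⟩ := hgrow _ hTX
      have h := hqmax _ (FAS.mul_mem_fasPositions hd hx)
      rw [hcancel] at h
      refine le_trans ?_ h
      calc c ^ L * (D / d₀) ^ (2 * L) = ∏ _l : Fin L, c * (D / d₀) ^ 2 := by
            rw [Finset.prod_const, Finset.card_univ, Fintype.card_fin, mul_pow, pow_mul]
        _ ≤ FAS.criterion x u := Finset.prod_le_prod (fun l _ => by positivity) fun l _ => hxc l
    have hqup : Hq ≤ (N : ℝ) ^ L * (D / d₀) ^ (2 * L) :=
      FAS.criterion_le_of_mem_Icc (FAS.div_mem_fasPositions hd hq) u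
    have hHp0 : 0 < Hp := hm.trans_le hmp
    have hgain : FAS.gain d₀ σ Np P θ D (FAS.classicalPositions κ N d₀ D) = Hq / Hp := by
      rw [FAS.gain, hpv, hqv, mul_div_mul_left _ _ hsc.ne']
    have hrate : D ^ (2 * L) / ((N : ℝ) ^ (2 * L) * ((N : ℝ) - 1) ^ (2 * L) * d₀ ^ (2 * L)) =
        (D / d₀) ^ (2 * L) / W := by
      rw [← hW, div_pow, div_div, mul_comm W]
    have hX0 : 0 ≤ (D / d₀) ^ (2 * L) := by positivity
    rw [hgain, hrate]
    constructor
    · calc c ^ L * W / B * ((D / d₀) ^ (2 * L) / W) = c ^ L * (D / d₀) ^ (2 * L) / B := by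
            field_simp
        _ ≤ Hq / Hp := div_le_div₀ ((by positivity : (0 : ℝ) ≤ _).trans hqlow) hqlow hHp0 hpB
    · calc Hq / Hp ≤ (N : ℝ) ^ L * (D / d₀) ^ (2 * L) / m :=
            div_le_div₀ (by positivity) hqup hm hmp
        _ = (N : ℝ) ^ L * W / m * ((D / d₀) ^ (2 * L) / W) := by field_simp
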